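/- Conventions. Let $R$ be a commutative ring, $\beta\in R$ (for instance $R=\mathbb Z[\beta]$), and $x=(x_1,x_2,\dots)$ formal variables; identities hold in the power series ring $R[[x]]$. Partitions are padded by zeros, $\ell(\lambda)$ is the number of nonzero parts, and $X_{[r,s]}=x_r+\dots+x_s$ ($=0$ if $r>s$; empty products are $1$). For an alphabet $Y$, $h_a[Y]$ is the complete homogeneous symmetric function of its letters, extended to integer combinations of letters by $h_a[Y-Z]=\sum_{c+d=a}h_c[Y](-1)^d e_d[Z]$, with $h_a=0$ for $a<0$; and $h_m[Y\ominus Z]=\sum_{a-b=m}h_a[Y]h_b[Z]$. In $h_m[Y\ominus k\overline\beta]$, $\overline\beta=-\beta$ is treated as one letter taken $k\in\mathbb Z$ times. A set-valued tableau of shape $\lambda/\mu$ fills each cell with a nonempty finite set of positive integers such that $\max T(i,j)\le\min T(i,j+1)$ and $\max T(i,j)<\min T(i+1,j)$ whenever the cells lie in $\lambda/\mu$. For sequences $f,g$ of positive integers put $$G_{\lambda/\mu,f/g}(x)=\sum_T\beta^{|T|-|\lambda/\mu|}x^T,$$ the sum over set-valued tableaux of shape $\lambda/\mu$ whose entries in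 row $i$ lie in $\{g_i,\dots,f_i\}$, where $|T|$ is the total number of entries. Define $G^{[p/q]}_m(x)$, $m\in\mathbb Z$, by $$\sum_{m\in\mathbb Z}G^{[p/q]}_m(x)u^m=\frac1{1+\beta u^{-1}}\prod_{q\le i\le p}\frac{1+\beta x_i}{1-x_iu},$$ with the first factor expanded in powers of $u^{-1}$ and the others in powers of $u$. For sequences $\alpha=(\alpha_i)_{i\ge1}$, $b=(b_i)_{i\ge1}$ in $R$ put $A_k=\alpha_1+\dots+\alpha_k$, $B_k=b_1+\dots+b_k$ (as formal sums of letters). A marked multiset-valued tableau of shape $\lambda/\mu$ fills each cell with a nonempty finite multiset $\{a_1\le\dots\le a_k\}$ of positive integers, in which $a_i$ may be marked if $i\ge2$ and $a_{i-1}<a_i$, subject to the same row and column inequalities. Let $$G^{\mathrm{row}(r,s)}_{\lambda/\mu}(x;\alpha,b)=\sum_T\prod_{(i,j)\in\lambda/\mu}x^{T(i,j)}\alpha_j^{\mathrm{unmarked}(T(i,j))-1}(-b_i)^{\mathrm{marked}(T(i,j))},$$ the sum over those whose entries in row $i$ lie in $[r_i,s_i]$, where $\mathrm{unmarked}$ and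 $\mathrm{marked}$ count the unmarked and marked entries of a cell. Theorem. Let $\lambda,\mu$ be partitions with at most $n$ parts, $\mu\subseteq\lambda$, and let $f=(f_1,\dots,f_n)$, $g=(g_1,\dots,g_n)$ be sequences of positive integers such that $g_i\le g_{i+1}$ and $f_i\le f_{i+1}$ whenever $1\le i\le n-1$ and $\mu_i<\lambda_{i+1}$. Write $\ell=\ell(\lambda)$ and $C_\ell=\prod_{i=1}^{\ell}\prod_{l=g_i}^{f_i}(1+\beta x_l)$. (1) $$G_{\lambda/\mu,f/g}(x)=C_\ell\,\det\Big(h_{\lambda_i-\mu_j-i+j}\big[X_{[g_j,f_i]}\ominus(j-i+1)\overline\beta\big]\Big)_{i,j=1}^{\ell}.$$ (2) This is equivalent to Matsumura's formula $$G_{\lambda/\mu,f/g}(x)=\det\Big(\sum_{s\ge0}\binom{i-j}{s}\beta^sG^{[f_i/g_j]}_{\lambda_i-\mu_j-i+j+s}(x)\Big)_{i,j=1}^{\ell},$$ which thus also holds: for all $1\le i,j\le\ell$, $$\sum_{s\ge0}\binom{i-j}{s}\beta^sG^{[f_i/g_j]}_{\lambda_i-\mu_j-i+j+s}(x)=\prod_{l=g_j}^{f_i}(1+\beta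 x_l)\cdot h_{\lambda_i-\mu_j-i+j}\big[X_{[g_j,f_i]}\ominus(j-i+1)\overline\beta\big],$$ and the right-hand sides of the two determinant formulas are equal. (3) The formula (1) is the specialization $n=\ell$, $r=g$, $s=f$, $\alpha=(0,0,\dots)$, $b=(-\beta,-\beta,\dots)$ of the row-flagged Jacobi–Trudi formula $$G^{\mathrm{row}(r,s)}_{\lambda/\mu}(x;\alpha,b)=\prod_{i=1}^n\prod_{l=r_i}^{s_i}(1-b_ix_l)\,\det\Big(h_{\lambda_i-\mu_j-i+j}\big[X_{[r_j,s_i]}\ominus(A_{\lambda_i}-A_{\mu_j}-B_{i-1}+B_j)\big]\Big)_{i,j=1}^n:$$ under it the left-hand side becomes $G_{\lambda/\mu,f/g}(x)$, the product becomes $C_\ell$, and the matrix becomes, entry by entry, the matrix in (1). -/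

import Mathlib

/-!
Conventions.  Partitions are Mathlib's `YoungDiagram`s, so rows and columns are numbered from `0`:
`lam.rowLen i` is the part with (one-based) index `i + 1`, and the flags `f i`, `g i` belong to that
same row.  The formal variables and the parameters `α`, `β` keep their one-based names:
`x_l` is `MvPowerSeries.X l` and `α l`, `β l` are the `l`-th parameters, for `l ≥ 1`
(index `0` never occurs).
-/

namespace FlaggedGrothendieck

open scoped Classical in
/-- `h_n(y_k : k ∈ S)`, the sum of all monomials of degree `n` in the letters `y_k`, `k ∈ S`. -/
noncomputable def completeSymm {κ A : Type*} [CommRing A] (S : Finset κ) (y : κ → A) (n : ℕ) : A :=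
  ∑ m ∈ S.finsuppAntidiag n, ∏ k ∈ S, y k ^ m k

/-- `e_n(y_k : k ∈ S)`, the sum of all squarefree monomials of degree `n` in the letters
`y_k`, `k ∈ S`. -/
noncomputable def elemSymm {κ A : Type*} [CommRing A] (S : Finset κ) (y : κ → A) (n : ℕ) : A :=
  ∑ t ∈ S.powersetCard n, ∏ k ∈ t, y k

/-- For an integer combination `Z` of letters: the set consisting of `Z i` labelled copies of each
letter `i` with `Z i > 0`. -/
noncomputable def posCopies {ι : Type*} (Z : ι →₀ ℤ) : Finset (Σ _ : ι, ℕ) :=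
  Z.support.sigma fun i => Finset.range (Z i).toNat

/-- The plethystic substitution `h_n[Z]`, where `Z = ∑ i, Z i • (letter i)` is an integer combination
of letters and the letter `i` takes the value `y i`.  Writing `Z = P - N` with `P` and `N` the
positive and the negative part, it is `∑_{a+b=n} h_a[P] h_b[-N]` with `h_b[-N] = (-1)^b e_b[N]`;
it is `0` for `n < 0`. -/
noncomputable def plethH {ι A : Type*} [CommRing A] (Z : ι →₀ ℤ) (y : ι → A) (n : ℤ) : A :=
  if n < 0 then 0
  else ∑ p ∈ Finset.HasAntidiagonal.antidiagonal n.toNat,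
    completeSymm (posCopies Z) (fun k => y k.1) p.1 *
      ((-1) ^ p.2 * elemSymm (posCopies (-Z)) (fun k => y k.1) p.2)

/-- The sum of a family of formal power series, taken coefficient by coefficient.  It is used only
for families in which every monomial occurs in finitely many members. -/
noncomputable def formalSum {ι R : Type*} [CommRing R] (F : ι → MvPowerSeries ℕ R) :
    MvPowerSeries ℕ R :=
  fun d => ∑ᶠ i, MvPowerSeries.coeff d (F i)

/-- `h_n[Y ⊖ Z] = ∑_{a-b=n} h_a[Y] h_b[Z]`, where `Y` is an integer combination of the variables
`x_l` and `Z` one of letters with values `z` in the coefficient ring. -/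
noncomputable def ominusH {ι R : Type*} [CommRing R] (Y : ℕ →₀ ℤ) (Z : ι →₀ ℤ) (z : ι → R)
    (n : ℤ) : MvPowerSeries ℕ R :=
  formalSum fun b : ℕ =>
    plethH Y (fun l => (MvPowerSeries.X l : MvPowerSeries ℕ R)) (n + b) *
      MvPowerSeries.C (plethH Z z (b : ℤ))

/-- `X_{[r,s]} = x_r + ⋯ + x_s`, and `0` if `r > s`. -/
noncomputable def Xint (r s : ℕ) : ℕ →₀ ℤ := ∑ l ∈ Finset.Icc r s, Finsupp.single l 1

/-- `A_n = α_1 + ⋯ + α_n`, as a combination of the letters `α_k` (left summand). -/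
noncomputable def Asum (n : ℕ) : ℕ ⊕ ℕ →₀ ℤ :=
  ∑ k ∈ Finset.Icc 1 n, Finsupp.single (Sum.inl k) 1

/-- `B_n = β_1 + ⋯ + β_n`, as a combination of the letters `β_k` (right summand). -/
noncomputable def Bsum (n : ℕ) : ℕ ⊕ ℕ →₀ ℤ :=
  ∑ k ∈ Finset.Icc 1 n, Finsupp.single (Sum.inr k) 1

/-- The number `ℓ(λ)` of (nonzero) parts. -/
def numParts (lam : YoungDiagram) : ℕ := lam.colLen 0

/-- The cells of the skew shape `λ/μ`. -/
def skewCells (lam mu : YoungDiagram) : Finset (ℕ × ℕ) := lam.cells \ mu.cells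

/-! ### Flagged set-valued tableaux -/

/-- Set-valued tableaux of shape `λ/μ`: fillings with nonempty finite sets of positive integers,
with `max T(i,j) ≤ min T(i,j+1)` and `max T(i,j) < min T(i+1,j)`. -/
def IsSetValuedTableau {lam mu : YoungDiagram} (T : skewCells lam mu → Finset ℕ) : Prop :=
  (∀ c, (T c).Nonempty ∧ ∀ a ∈ T c, 1 ≤ a) ∧
  (∀ c c' : skewCells lam mu, c'.1 = (c.1.1, c.1.2 + 1) → ∀ a ∈ T c, ∀ b ∈ T c', a ≤ b) ∧
  (∀ c c' : skewCells lam mu, c'.1 = (c.1.1 + 1, c.1.2) → ∀ a ∈ T c, ∀ b ∈ T c', a < b)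

open scoped Classical in
/-- `FSVT(λ/μ, f/g)`: the set-valued tableaux of shape `λ/μ` whose entries in row `i` lie in
`{g_i, …, f_i}`. -/
noncomputable def FSVT (lam mu : YoungDiagram) (f g : ℕ → ℕ) :
    Finset (skewCells lam mu → Finset ℕ) :=
  (Fintype.piFinset fun c : skewCells lam mu =>
    (Finset.Icc (g c.1.1) (f c.1.1)).powerset).filter IsSetValuedTableau

/-- Matsumura's flagged Grothendieck polynomial
`G_{λ/μ,f/g}(x) = ∑_{T ∈ FSVT(λ/μ,f/g)} β^{|T|-|λ/μ|} x^T`. -/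
noncomputable def flaggedG {R : Type*} [CommRing R] (β : R) (lam mu : YoungDiagram) (f g : ℕ → ℕ) :
    MvPolynomial ℕ R :=
  ∑ T ∈ FSVT lam mu f g,
    MvPolynomial.C (β ^ ((∑ c, (T c).card) - (skewCells lam mu).card)) *
      ∏ c, ∏ a ∈ T c, MvPolynomial.X a

/-! ### Matsumura's determinant -/

/-- `∏_{q ≤ l ≤ p} (1 + β x_l) / (1 - x_l u)` as a power series in `u`. -/
noncomputable def matsumuraProd {R : Type*} [CommRing R] (β : R) (p q : ℕ) :
    PowerSeries (MvPowerSeries ℕ R) :=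
  ∏ l ∈ Finset.Icc q p,
    (PowerSeries.C (1 + MvPowerSeries.C β * MvPowerSeries.X l) *
      PowerSeries.mk fun k => (MvPowerSeries.X l : MvPowerSeries ℕ R) ^ k)

/-- `G_m^{[p/q]}(x)`, the coefficient of `u^m` (`m ∈ ℤ`) in
`(1 + β u⁻¹)⁻¹ ∏_{q ≤ l ≤ p} (1 + β x_l) / (1 - x_l u)`, where
`(1 + β u⁻¹)⁻¹ = ∑_{k ≥ 0} (-β)^k u^{-k}`. -/
noncomputable def matsumuraG {R : Type*} [CommRing R] (β : R) (p q : ℕ) (m : ℤ) :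
    MvPowerSeries ℕ R :=
  formalSum fun k : ℕ =>
    MvPowerSeries.C ((-β) ^ k) *
      (if m + k < 0 then 0 else PowerSeries.coeff (m + k).toNat (matsumuraProd β p q))

/-- The matrix with entries `∑_{s ≥ 0} binom(i-j, s) β^s G^{[f_i/g_j]}_{λ_i-μ_j-i+j+s}(x)`,
of size `ℓ(λ)`. -/
noncomputable def matsumuraMatrix {R : Type*} [CommRing R] (β : R) (lam mu : YoungDiagram)
    (f g : ℕ → ℕ) : Matrix (Fin (numParts lam)) (Fin (numParts lam)) (MvPowerSeries ℕ R) :=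
  Matrix.of fun i j => formalSum fun s : ℕ =>
    MvPowerSeries.C (((Ring.choose ((i : ℤ) - (j : ℤ)) s : ℤ) : R) * β ^ s) *
      matsumuraG β (f i) (g j)
        ((lam.rowLen i : ℤ) - (mu.rowLen j : ℤ) - (i : ℤ) + (j : ℤ) + (s : ℤ))

/-- The matrix with entries `h_{λ_i-μ_j-i+j}[X_{[g_j,f_i]} ⊖ (j-i+1)(-β)]`, of size `ℓ(λ)`;
here `-β` is a single letter, taken `j-i+1` times. -/
noncomputable def ominusMatrix {R : Type*} [CommRing R] (β : R) (lam mu : YoungDiagram)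
    (f g : ℕ → ℕ) : Matrix (Fin (numParts lam)) (Fin (numParts lam)) (MvPowerSeries ℕ R) :=
  Matrix.of fun i j =>
    ominusH (Xint (g j) (f i))
      (Finsupp.single () ((j : ℤ) - (i : ℤ) + 1)) (fun _ => -β)
      ((lam.rowLen i : ℤ) - (mu.rowLen j : ℤ) - (i : ℤ) + (j : ℤ))

/-- `∏_{i=1}^{n} ∏_{l=g_i}^{f_i} (1 + β x_l)`. -/
noncomputable def flagProd {R : Type*} [CommRing R] (β : R) (n : ℕ) (f g : ℕ → ℕ) :
    MvPowerSeries ℕ R :=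
  ∏ i ∈ Finset.range n, ∏ l ∈ Finset.Icc (g i) (f i),
    (1 + MvPowerSeries.C β * MvPowerSeries.X l)

/-! ### Marked multiset-valued tableaux -/

/-- Marked multiset-valued tableaux of shape `λ/μ`.  A cell `c` carries a nonempty multiset
`(T c).1 = {a_1 ≤ ⋯ ≤ a_k}` of positive integers in which `a_i` may be marked if `i ≥ 2` and
`a_{i-1} < a_i`; so the marked entry is the first occurrence of a value other than the minimum, and
`(T c).2` is the set of the values marked in this way. -/
def IsMMSVT {lam mu : YoungDiagram} (T : skewCells lam mu → Multiset ℕ × Finset ℕ) : Prop :=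
  (∀ c, (T c).1 ≠ 0 ∧ (∀ a ∈ (T c).1, 1 ≤ a) ∧
    ∀ k ∈ (T c).2, k ∈ (T c).1 ∧ ∃ a ∈ (T c).1, a < k) ∧
  (∀ c c' : skewCells lam mu, c'.1 = (c.1.1, c.1.2 + 1) →
    ∀ a ∈ (T c).1, ∀ b ∈ (T c').1, a ≤ b) ∧
  (∀ c c' : skewCells lam mu, c'.1 = (c.1.1 + 1, c.1.2) →
    ∀ a ∈ (T c).1, ∀ b ∈ (T c').1, a < b)

/-- `MMSVT^{row(r,s)}(λ/μ)`: all entries in row `i` lie between `r_i` and `s_i`. -/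
def MMSVTrow (lam mu : YoungDiagram) (r s : ℕ → ℕ) :
    Set (skewCells lam mu → Multiset ℕ × Finset ℕ) :=
  {T | IsMMSVT T ∧ ∀ c, ∀ a ∈ (T c).1, r c.1.1 ≤ a ∧ a ≤ s c.1.1}

/-- `wt(T) = ∏_{(i,j)} x^{T(i,j)} α_j^{unmarked(T(i,j))-1} (-β_i)^{marked(T(i,j))}`. -/
noncomputable def wtMMSVT {R : Type*} [CommRing R] (α β : ℕ → R) {lam mu : YoungDiagram}
    (T : skewCells lam mu → Multiset ℕ × Finset ℕ) : MvPowerSeries ℕ R :=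
  ∏ c : skewCells lam mu,
    (((T c).1.map fun a => (MvPowerSeries.X a : MvPowerSeries ℕ R)).prod *
      MvPowerSeries.C (α (c.1.2 + 1) ^ ((T c).1.card - (T c).2.card - 1) *
        (-β (c.1.1 + 1)) ^ (T c).2.card))

/-- The row-flagged refined canonical stable Grothendieck polynomial
`G_{λ/μ}^{row(r,s)}(x; α, β) = ∑_{T ∈ MMSVT^{row(r,s)}(λ/μ)} wt(T)`. -/
noncomputable def rowG {R : Type*} [CommRing R] (α β : ℕ → R) (lam mu : YoungDiagram)
    (r s : ℕ → ℕ) : MvPowerSeries ℕ R :=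
  formalSum fun T : MMSVTrow lam mu r s => wtMMSVT α β T.1

/-- `∏_{i=1}^n ∏_{l=r_i}^{s_i} (1 - β_i x_l)`. -/
noncomputable def rowProd {R : Type*} [CommRing R] (β : ℕ → R) (n : ℕ) (r s : ℕ → ℕ) :
    MvPowerSeries ℕ R :=
  ∏ i ∈ Finset.range n, ∏ l ∈ Finset.Icc (r i) (s i),
    (1 - MvPowerSeries.C (β (i + 1)) * MvPowerSeries.X l)

/-- The `n × n` matrix with (one-based) entries
`h_{λ_i-μ_j-i+j}[X_{[r_j,s_i]} ⊖ (A_{λ_i} - A_{μ_j} - B_{i-1} + B_j)]`. -/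
noncomputable def rowMatrix {R : Type*} [CommRing R] (α β : ℕ → R) (n : ℕ)
    (lam mu : YoungDiagram) (r s : ℕ → ℕ) : Matrix (Fin n) (Fin n) (MvPowerSeries ℕ R) :=
  Matrix.of fun i j =>
    ominusH (Xint (r j) (s i))
      (Asum (lam.rowLen i) - Asum (mu.rowLen j) - Bsum i + Bsum (j + 1)) (Sum.elim α β)
      ((lam.rowLen i : ℤ) - (mu.rowLen j : ℤ) - (i : ℤ) + (j : ℤ))

end FlaggedGrothendieck

/-! Each entry is the coefficient h(p,k,m) of u^m in E(u)S(u⁻¹), where E = ∏ (1 - x_l u)⁻¹ over an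
interval with upper end p and S(v) = (1 + βv)^(-k). Two relations drive the proof: h(p,k,m) =
h(p-1,k,m) + x_p h(p,k,m-1) and h(p,k-1,m-1) = h(p,k,m-1) + β h(p,k,m).

Tableaux obey matching recursions. If row i ends in a removable corner and its flag exceeds that of
a connected row above, sorting tableaux by the corner cell (without f_i, with f_i and more, only
f_i) gives `tableauSum_corner`; the first relation and linearity in row i give the same recursion
for the determinant (`det_weightedMatrix_corner`). If the next row has the same end and flag, f_i
cannot occur in row i; lowering it is then, by both relations together, the addition of a multiple
of row i+1 to row i (`det_weightedMatrix_shift`). `tableauSum_eq_det` is the resulting induction.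

The weights ∏_{g_i..f_i}(1+βx) and ∏_{g_j..f_i}(1+βx) of formulas (1) and (2) differ by a diagonal
conjugation only while no interval is empty. The induction is therefore run for an abstract weight
`W` (`IsFlagWeight`) covering both. The entrywise comparison is the binomial series of
(1+βu⁻¹)^(i-j). In the specialization, α = 0 leaves one unmarked entry per cell. -/

namespace FlaggedGrothendieck

/-! ### Generating series of the plethystic h_n -/

section PlethysticSeries

variable {A ι : Type*} [CommRing A]

/-- The unit `1 - y u` of the power series ring, with inverse `∑ y ^ k u ^ k`. -/
noncomputable def oneSubUnit (y : A) : (PowerSeries A)ˣ where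
  val := 1 - PowerSeries.C y * PowerSeries.X
  inv := PowerSeries.mk fun k => y ^ k
  val_inv := by
    ext n
    cases n with
    | zero => simp [sub_mul, mul_assoc]
    | succ n => simp [sub_mul, mul_assoc, PowerSeries.coeff_succ_X_mul, pow_succ', PowerSeries.coeff_one]
  inv_val := by
    rw [mul_comm]
    ext n
    cases n with
    | zero => simp [sub_mul, mul_assoc]
    | succ n => simp [sub_mul, mul_assoc, PowerSeries.coeff_succ_X_mul, pow_succ', PowerSeries.coeff_one]

/-- The generating series `∏ (1 - y_i u) ^ (-Z_i)` of the `h_n[Z]`. -/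
noncomputable def plethSeries (Z : ι →₀ ℤ) (y : ι → A) : (PowerSeries A)ˣ :=
  Z.prod fun i n => oneSubUnit (y i) ^ (-n)

theorem plethSeries_add (Z Z' : ι →₀ ℤ) (y : ι → A) :
    plethSeries (Z + Z') y = plethSeries Z y * plethSeries Z' y := by
  classical
  exact Finsupp.prod_add_index' (by simp) (fun i m n => by rw [neg_add, zpow_add])

theorem plethSeries_neg (Z : ι →₀ ℤ) (y : ι → A) :
    plethSeries (-Z) y = (plethSeries Z y)⁻¹ := by
  rw [eq_inv_iff_mul_eq_one, ← plethSeries_add]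
  simp [plethSeries]

theorem plethSeries_single (i : ι) (n : ℤ) (y : ι → A) :
    plethSeries (Finsupp.single i n) y = oneSubUnit (y i) ^ (-n) :=
  Finsupp.prod_single_index (by simp)

theorem plethSeries_sum {κ : Type*} (s : Finset κ) (Z : κ → ι →₀ ℤ) (y : ι → A) :
    plethSeries (∑ k ∈ s, Z k) y = ∏ k ∈ s, plethSeries (Z k) y := by
  classical
  induction s using Finset.induction_on with
  | empty => simp [plethSeries]
  | insert a s ha ih => rw [Finset.sum_insert ha, Finset.prod_insert ha, plethSeries_add, ih]

theorem completeSymm_eq_coeff {κ : Type*} (S : Finset κ) (y : κ → A) (n : ℕ) :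
    completeSymm S y n =
      PowerSeries.coeff n (∏ k ∈ S, (PowerSeries.mk fun j => y k ^ j : PowerSeries A)) := by
  classical
  rw [PowerSeries.coeff_prod, completeSymm]
  simp only [PowerSeries.coeff_mk]

theorem elemSymm_eq_coeff {κ : Type*} (S : Finset κ) (y : κ → A) (n : ℕ) :
    (-1) ^ n * elemSymm S y n =
      PowerSeries.coeff n (∏ k ∈ S, (1 - PowerSeries.C (y k) * PowerSeries.X)) := by
  classical
  simp only [sub_eq_add_neg]
  rw [Finset.prod_one_add, map_sum, elemSymm, Finset.mul_sum, Finset.powersetCard_eq_filter,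
    Finset.sum_filter]
  refine Finset.sum_congr rfl fun t _ => ?_
  have h : ∏ k ∈ t, -(PowerSeries.C (y k) * PowerSeries.X) =
      PowerSeries.C ((-1) ^ t.card * ∏ k ∈ t, y k) * PowerSeries.X ^ t.card := by
    rw [Finset.prod_neg, Finset.prod_mul_distrib, Finset.prod_const, map_mul, map_prod, map_pow,
      map_neg, map_one, mul_assoc]
  rw [h, PowerSeries.coeff_C_mul, PowerSeries.coeff_X_pow]
  by_cases hn : t.card = n
  · simp [hn]
  · simp [hn, Ne.symm hn]

theorem prod_posCopies {M : Type*} [CommMonoid M] (Z : ι →₀ ℤ) (v : ι → M) :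
    ∏ k ∈ posCopies Z, v k.1 = Z.prod fun i n => v i ^ n.toNat := by
  rw [posCopies, Finset.prod_sigma]
  simp [Finsupp.prod]

/-- The coefficient of `u ^ n`, for an integer `n`. -/
noncomputable def intCoeff (E : PowerSeries A) (n : ℤ) : A :=
  if n < 0 then 0 else PowerSeries.coeff n.toNat E

/-- This replaces alphabets by units of a power series ring: sums of alphabets become products,
differences become quotients. -/
theorem plethH_eq_intCoeff (Z : ι →₀ ℤ) (y : ι → A) (n : ℤ) :
    plethH Z y n = intCoeff (plethSeries Z y : PowerSeries A) n := by
  unfold plethH intCoeff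
  split_ifs with h
  · rfl
  · simp only [completeSymm_eq_coeff, elemSymm_eq_coeff]
    rw [← PowerSeries.coeff_mul]
    congr 1
    rw [prod_posCopies Z fun i => (PowerSeries.mk fun j => y i ^ j : PowerSeries A),
      prod_posCopies (-Z) fun i => (1 - PowerSeries.C (y i) * PowerSeries.X : PowerSeries A)]
    simp only [Finsupp.prod, plethSeries, Finsupp.support_neg, Units.coe_prod]
    rw [← Finset.prod_mul_distrib]
    refine Finset.prod_congr rfl fun i _ => ?_
    change (((oneSubUnit (y i))⁻¹ : (PowerSeries A)ˣ) : PowerSeries A) ^ _ *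
      ((oneSubUnit (y i) : (PowerSeries A)ˣ) : PowerSeries A) ^ _ = _
    rw [← Units.val_pow_eq_pow_val, ← Units.val_pow_eq_pow_val, ← Units.val_mul]
    congr 1
    -- The positive and negative parts of Z i recombine: -Z⁺ + Z⁻ = -Z.
    rw [inv_pow, ← zpow_natCast, ← zpow_natCast, ← zpow_neg, ← zpow_add]
    congr 1
    simp only [Finsupp.coe_neg, Pi.neg_apply]
    omega

theorem intCoeff_of_neg (E : PowerSeries A) {n : ℤ} (hn : n < 0) : intCoeff E n = 0 := if_pos hn

theorem intCoeff_natCast (E : PowerSeries A) (n : ℕ) : intCoeff E n = PowerSeries.coeff n E := by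
  simp [intCoeff]

theorem intCoeff_add (E F : PowerSeries A) (n : ℤ) :
    intCoeff (E + F) n = intCoeff E n + intCoeff F n := by
  unfold intCoeff; split_ifs <;> simp

theorem intCoeff_C_mul (a : A) (E : PowerSeries A) (n : ℤ) :
    intCoeff (PowerSeries.C a * E) n = a * intCoeff E n := by
  unfold intCoeff; split_ifs <;> simp

theorem intCoeff_X_mul (E : PowerSeries A) (n : ℤ) :
    intCoeff (PowerSeries.X * E) n = intCoeff E (n - 1) := by
  rcases lt_or_ge n 0 with h | h
  · rw [intCoeff_of_neg _ h, intCoeff_of_neg _ (by omega)]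
  · lift n to ℕ using h
    cases n with
    | zero => rw [intCoeff_of_neg _ (by simp : ((0 : ℕ) : ℤ) - 1 < 0), intCoeff_natCast]; simp
    | succ n =>
      rw [intCoeff_natCast, PowerSeries.coeff_succ_X_mul, ← intCoeff_natCast]
      simp

end PlethysticSeries

/-! ### Locally finite sums and the pairing E(u)S(u⁻¹) -/

section FormalSums

variable {R : Type*} [CommRing R]

/-- The family `F` has only finitely many members involving a given monomial. -/
def LocallyFinite (F : ℕ → MvPowerSeries ℕ R) : Prop :=
  ∀ d : ℕ →₀ ℕ, ∃ B, ∀ b, B ≤ b → MvPowerSeries.coeff d (F b) = 0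

theorem coeff_formalSum (F : ℕ → MvPowerSeries ℕ R) (d : ℕ →₀ ℕ) {B : ℕ}
    (hB : ∀ b, B ≤ b → MvPowerSeries.coeff d (F b) = 0) :
    MvPowerSeries.coeff d (formalSum F) = ∑ b ∈ Finset.range B, MvPowerSeries.coeff d (F b) := by
  change ∑ᶠ i, MvPowerSeries.coeff d (F i) = _
  refine finsum_eq_sum_of_support_subset _ fun b hb => ?_
  by_contra h
  exact hb (hB b (by simpa using h))

theorem formalSum_add {F G : ℕ → MvPowerSeries ℕ R} (hF : LocallyFinite F)
    (hG : LocallyFinite G) : formalSum (fun b => F b + G b) = formalSum F + formalSum G := by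
  ext d
  obtain ⟨B, hB⟩ := hF d
  obtain ⟨B', hB'⟩ := hG d
  have h1 := coeff_formalSum F d (B := B + B') fun b hb => hB b (by omega)
  have h2 := coeff_formalSum G d (B := B + B') fun b hb => hB' b (by omega)
  rw [map_add, h1, h2, coeff_formalSum _ d (B := B + B')
    (fun b hb => by rw [map_add, hB b (by omega), hB' b (by omega), add_zero])]
  simp [Finset.sum_add_distrib]

/-- A monomial has finitely many factorizations, so the largest of their bounds makes both sums
finite. -/
theorem formalSum_mul_left (a : MvPowerSeries ℕ R) {F : ℕ → MvPowerSeries ℕ R}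
    (hF : LocallyFinite F) : formalSum (fun b => a * F b) = a * formalSum F := by
  classical
  ext d
  choose B hB using hF
  have key : ∀ p ∈ Finset.HasAntidiagonal.antidiagonal d, ∀ b,
      (Finset.HasAntidiagonal.antidiagonal d).sup (fun p => B p.2) ≤ b → MvPowerSeries.coeff p.2 (F b) = 0 :=
    fun p hp b hb => hB _ _ ((Finset.le_sup (f := fun p : (ℕ →₀ ℕ) × (ℕ →₀ ℕ) => B p.2) hp).trans hb)
  rw [coeff_formalSum _ d (B := (Finset.HasAntidiagonal.antidiagonal d).sup fun p => B p.2), MvPowerSeries.coeff_mul]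
  · simp only [MvPowerSeries.coeff_mul]
    rw [Finset.sum_comm]
    refine Finset.sum_congr rfl fun p hp => ?_
    rw [coeff_formalSum F p.2 (key p hp), Finset.mul_sum]
  · intro b hb
    rw [MvPowerSeries.coeff_mul]
    exact Finset.sum_eq_zero fun p hp => by rw [key p hp b hb, mul_zero]

theorem formalSum_succ {F : ℕ → MvPowerSeries ℕ R} (hF : LocallyFinite F) :
    formalSum F = F 0 + formalSum (fun b => F (b + 1)) := by
  ext d
  obtain ⟨B, hB⟩ := hF d
  rw [map_add, coeff_formalSum F d (B := B + 1) (fun b hb => hB b (by omega)),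
    coeff_formalSum _ d (B := B) (fun b hb => hB _ (by omega)), Finset.sum_range_succ', add_comm]

theorem formalSum_eq_zero {F : ℕ → MvPowerSeries ℕ R} (hF : ∀ b, F b = 0) : formalSum F = 0 := by
  ext d
  rw [coeff_formalSum F d (B := 0) (fun b _ => by simp [hF])]
  simp

/-- The coefficient of `u ^ n` only involves monomials of degree at least `n`. -/
def IsAdic (E : PowerSeries (MvPowerSeries ℕ R)) : Prop :=
  ∀ n d, d.degree < n → MvPowerSeries.coeff d (PowerSeries.coeff n E) = 0

theorem IsAdic.mul {E F : PowerSeries (MvPowerSeries ℕ R)} (hE : IsAdic E) (hF : IsAdic F) :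
    IsAdic (E * F) := by
  classical
  intro n d hd
  rw [PowerSeries.coeff_mul, map_sum]
  refine Finset.sum_eq_zero fun p hp => ?_
  rw [MvPowerSeries.coeff_mul]
  refine Finset.sum_eq_zero fun e he => ?_
  rw [Finset.HasAntidiagonal.mem_antidiagonal] at hp he
  have hdeg : e.1.degree + e.2.degree = d.degree := by rw [← he, map_add]
  rcases lt_or_ge e.1.degree p.1 with h | h
  · rw [hE _ _ h, zero_mul]
  · rw [hF _ _ (by omega), mul_zero]

theorem isAdic_one : IsAdic (1 : PowerSeries (MvPowerSeries ℕ R)) := by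
  intro n d hd
  rw [PowerSeries.coeff_one, if_neg (by omega), map_zero]

theorem isAdic_C (a : MvPowerSeries ℕ R) : IsAdic (PowerSeries.C a) := by
  intro n d hd
  rw [PowerSeries.coeff_C, if_neg (by omega), map_zero]

theorem isAdic_geom (l : ℕ) :
    IsAdic (PowerSeries.mk fun k => (MvPowerSeries.X l : MvPowerSeries ℕ R) ^ k) := by
  classical
  intro n d hd
  rw [PowerSeries.coeff_mk, MvPowerSeries.coeff_X_pow, if_neg]
  rintro rfl
  simp at hd

theorem isAdic_prod {κ : Type*} (s : Finset κ) (E : κ → PowerSeries (MvPowerSeries ℕ R))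
    (h : ∀ k ∈ s, IsAdic (E k)) : IsAdic (∏ k ∈ s, E k) :=
  Finset.prod_induction _ _ (fun _ _ => IsAdic.mul) isAdic_one h

theorem IsAdic.coeff_intCoeff {E : PowerSeries (MvPowerSeries ℕ R)} (hE : IsAdic E) {n : ℤ}
    {d : ℕ →₀ ℕ} (hd : (d.degree : ℤ) < n) : MvPowerSeries.coeff d (intCoeff E n) = 0 := by
  rw [intCoeff, if_neg (by omega)]
  exact hE _ _ (by omega)

/-- The coefficient of `u ^ m` in `E(u) S(u⁻¹)`. -/
noncomputable def pairing (E : PowerSeries (MvPowerSeries ℕ R)) (S : PowerSeries R) (m : ℤ) :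
    MvPowerSeries ℕ R :=
  formalSum fun b : ℕ => intCoeff E (m + b) * MvPowerSeries.C (PowerSeries.coeff b S)

theorem IsAdic.locallyFinite {E : PowerSeries (MvPowerSeries ℕ R)} (hE : IsAdic E)
    (a : ℕ → MvPowerSeries ℕ R) (m : ℤ) :
    LocallyFinite fun b : ℕ => intCoeff E (m + b) * a b := by
  classical
  intro d
  refine ⟨(d.degree + 1 - m).toNat, fun b hb => ?_⟩
  rw [MvPowerSeries.coeff_mul]
  refine Finset.sum_eq_zero fun e he => ?_
  rw [Finset.HasAntidiagonal.mem_antidiagonal] at he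
  have hdeg : e.1.degree + e.2.degree = d.degree := by rw [← he, map_add]
  rw [hE.coeff_intCoeff (by omega), zero_mul]

variable {E F : PowerSeries (MvPowerSeries ℕ R)}

theorem pairing_add_left (hE : IsAdic E) (hF : IsAdic F) (S : PowerSeries R) (m : ℤ) :
    pairing (E + F) S m = pairing E S m + pairing F S m := by
  unfold pairing
  rw [← formalSum_add (hE.locallyFinite _ m) (hF.locallyFinite _ m)]
  simp only [intCoeff_add, add_mul]

theorem pairing_C_mul (hE : IsAdic E) (a : MvPowerSeries ℕ R) (S : PowerSeries R) (m : ℤ) :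
    pairing (PowerSeries.C a * E) S m = a * pairing E S m := by
  unfold pairing
  rw [← formalSum_mul_left a (hE.locallyFinite _ m)]
  simp only [intCoeff_C_mul, mul_assoc]

theorem pairing_X_mul_left (S : PowerSeries R) (m : ℤ) :
    pairing (PowerSeries.X * E) S m = pairing E S (m - 1) := by
  unfold pairing
  simp only [intCoeff_X_mul]
  congr! 4
  ring

theorem pairing_add_right (hE : IsAdic E) (S S' : PowerSeries R) (m : ℤ) :
    pairing E (S + S') m = pairing E S m + pairing E S' m := by
  unfold pairing
  rw [← formalSum_add (hE.locallyFinite _ m) (hE.locallyFinite _ m)]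
  simp only [map_add, mul_add]

theorem pairing_C_mul_right (hE : IsAdic E) (a : R) (S : PowerSeries R) (m : ℤ) :
    pairing E (PowerSeries.C a * S) m = MvPowerSeries.C a * pairing E S m := by
  unfold pairing
  rw [← formalSum_mul_left _ (hE.locallyFinite _ m)]
  simp only [PowerSeries.coeff_C_mul, map_mul]
  congr! 2
  ring

/-- The variable of S stands for u⁻¹, hence the shift is opposite to that of `pairing_X_mul_left`.
-/
theorem pairing_X_mul_right (hE : IsAdic E) (S : PowerSeries R) (m : ℤ) :
    pairing E (PowerSeries.X * S) m = pairing E S (m + 1) := by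
  unfold pairing
  rw [formalSum_succ (hE.locallyFinite _ m)]
  simp only [PowerSeries.coeff_zero_X_mul, map_zero, mul_zero, zero_add,
    PowerSeries.coeff_succ_X_mul]
  congr! 4
  push_cast
  ring

theorem pairing_one_left (S : PowerSeries R) {m : ℤ} (hm : 0 < m) :
    pairing (1 : PowerSeries (MvPowerSeries ℕ R)) S m = 0 := by
  refine formalSum_eq_zero fun b => ?_
  rw [intCoeff, if_neg (by omega), PowerSeries.coeff_one, if_neg (by omega), zero_mul]

/-- At a fixed monomial only b < B matters, so the double sum is a finite triangle. It serves to
absorb the binomial sum of Matsumura's entries into one pairing. -/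
theorem pairing_mul_right (hE : IsAdic E) (S S' : PowerSeries R) (m : ℤ) :
    pairing E (S * S') m =
      formalSum fun s : ℕ => MvPowerSeries.C (PowerSeries.coeff s S) * pairing E S' (m + s) := by
  ext d
  set B := (d.degree + 1 - m).toNat with hBdef
  have hz : ∀ b : ℕ, B ≤ b → MvPowerSeries.coeff d (intCoeff E (m + b)) = 0 := fun b hb =>
    hE.coeff_intCoeff (by omega)
  have hp : ∀ s : ℕ, MvPowerSeries.coeff d (pairing E S' (m + s)) = ∑ k ∈ Finset.range (B - s),
      MvPowerSeries.coeff d (intCoeff E (m + (s + k : ℕ))) * PowerSeries.coeff k S' := by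
    intro s
    unfold pairing
    rw [coeff_formalSum _ d (B := B - s)]
    · refine Finset.sum_congr rfl fun k _ => ?_
      rw [MvPowerSeries.coeff_mul_C]
      push_cast
      rw [add_assoc]
    · intro b hb
      rw [MvPowerSeries.coeff_mul_C, add_assoc, ← Nat.cast_add, hz _ (by omega), zero_mul]
  rw [coeff_formalSum _ d (B := B)]
  · rw [pairing, coeff_formalSum _ d (B := B)]
    · simp only [MvPowerSeries.coeff_C_mul, hp, MvPowerSeries.coeff_mul_C, Finset.mul_sum]
      rw [← Finset.sum_range_diag_flip B fun s k => PowerSeries.coeff s S *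
        (MvPowerSeries.coeff d (intCoeff E (m + (s + k : ℕ))) * PowerSeries.coeff k S')]
      refine Finset.sum_congr rfl fun b _ => ?_
      rw [PowerSeries.coeff_mul, Finset.Nat.sum_antidiagonal_eq_sum_range_succ_mk, Finset.mul_sum]
      refine Finset.sum_congr rfl fun s hs => ?_
      rw [Nat.add_sub_cancel' (by simpa [Nat.lt_succ_iff] using hs)]
      ring
    · intro b hb
      rw [MvPowerSeries.coeff_mul_C, hz b hb, zero_mul]
  · intro b hb
    rw [MvPowerSeries.coeff_C_mul, hp, Nat.sub_eq_zero_of_le hb]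
    simp

end FormalSums

/-! ### Recursions and vanishing for the matrix entries -/

section IntervalSeries

variable {R : Type*} [CommRing R]

/-- `∏_{q ≤ l ≤ p} (1 - x_l u)⁻¹`. -/
noncomputable def intervalSeries (R : Type*) [CommRing R] (q p : ℕ) :
    (PowerSeries (MvPowerSeries ℕ R))ˣ :=
  plethSeries (Xint q p) (fun l => (MvPowerSeries.X l : MvPowerSeries ℕ R))

theorem intervalSeries_eq_prod (q p : ℕ) :
    (intervalSeries R q p : PowerSeries (MvPowerSeries ℕ R)) =
      ∏ l ∈ Finset.Icc q p, PowerSeries.mk fun k => (MvPowerSeries.X l : MvPowerSeries ℕ R) ^ k := by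
  rw [intervalSeries, Xint, plethSeries_sum, Units.coe_prod]
  refine Finset.prod_congr rfl fun l _ => ?_
  rw [plethSeries_single, zpow_neg, zpow_one]
  rfl

theorem isAdic_intervalSeries (q p : ℕ) :
    IsAdic (intervalSeries R q p : PowerSeries (MvPowerSeries ℕ R)) := by
  rw [intervalSeries_eq_prod]
  exact isAdic_prod _ _ fun l _ => isAdic_geom l

theorem intervalSeries_of_lt {q p : ℕ} (h : p < q) :
    (intervalSeries R q p : PowerSeries (MvPowerSeries ℕ R)) = 1 := by
  rw [intervalSeries_eq_prod, Finset.Icc_eq_empty (by omega), Finset.prod_empty]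

theorem prod_Icc_pred {M : Type*} [CommMonoid M] (v : ℕ → M) {q p : ℕ} (hp : 1 ≤ p) (h : q ≤ p) :
    ∏ l ∈ Finset.Icc q p, v l = (∏ l ∈ Finset.Icc q (p - 1), v l) * v p := by
  obtain ⟨p, rfl⟩ := Nat.exists_eq_add_of_le' hp
  rw [Finset.prod_Icc_succ_top h, Nat.add_sub_cancel]

/-- From 1/(1 - x_p u) = 1 + x_p u/(1 - x_p u). -/
theorem intervalSeries_pred {q p : ℕ} (hp : 1 ≤ p) (h : q ≤ p) :
    (intervalSeries R q p : PowerSeries (MvPowerSeries ℕ R)) =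
      (intervalSeries R q (p - 1) : PowerSeries (MvPowerSeries ℕ R)) +
        PowerSeries.C (MvPowerSeries.X p) * (PowerSeries.X *
          (intervalSeries R q p : PowerSeries (MvPowerSeries ℕ R))) := by
  have h1 : (1 - PowerSeries.C (MvPowerSeries.X p : MvPowerSeries ℕ R) * PowerSeries.X) *
      (PowerSeries.mk fun k => (MvPowerSeries.X p : MvPowerSeries ℕ R) ^ k) = 1 :=
    (oneSubUnit (MvPowerSeries.X p : MvPowerSeries ℕ R)).val_inv
  rw [intervalSeries_eq_prod, intervalSeries_eq_prod, prod_Icc_pred _ hp h]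
  set a := ∏ l ∈ Finset.Icc q (p - 1),
    PowerSeries.mk fun k => (MvPowerSeries.X l : MvPowerSeries ℕ R) ^ k
  linear_combination a * h1

/-- `h_m[X_{[q,p]} ⊖ k(-β)]`. -/
noncomputable def ominusEntry (β : R) (q p : ℕ) (k m : ℤ) : MvPowerSeries ℕ R :=
  pairing (intervalSeries R q p : PowerSeries (MvPowerSeries ℕ R))
    ((oneSubUnit (-β) ^ (-k) : (PowerSeries R)ˣ) : PowerSeries R) m

theorem ominusH_eq_pairing {ι : Type*} (q p : ℕ) (Z : ι →₀ ℤ) (z : ι → R) (m : ℤ) :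
    ominusH (Xint q p) Z z m =
      pairing (intervalSeries R q p : PowerSeries (MvPowerSeries ℕ R))
        (plethSeries Z z : PowerSeries R) m := by
  simp only [ominusH, pairing, plethH_eq_intCoeff, intCoeff_natCast, intervalSeries]

theorem ominusH_single (β : R) (q p : ℕ) (k m : ℤ) :
    ominusH (Xint q p) (Finsupp.single () k) (fun _ => -β) m = ominusEntry β q p k m := by
  rw [ominusH_eq_pairing, plethSeries_single, ominusEntry]

variable (β : R)

theorem ominusEntry_pred {q p : ℕ} (hp : 1 ≤ p) (h : q ≤ p) (k m : ℤ) :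
    ominusEntry β q p k m = ominusEntry β q (p - 1) k m +
      MvPowerSeries.X p * ominusEntry β q p k (m - 1) := by
  have hE := isAdic_intervalSeries (R := R) q p
  have hX : IsAdic (PowerSeries.C (MvPowerSeries.X p : MvPowerSeries ℕ R) * PowerSeries.X) := by
    intro n d hd
    rw [PowerSeries.coeff_C_mul, PowerSeries.coeff_X]
    split_ifs with hn
    · rw [mul_one, MvPowerSeries.coeff_X, if_neg]
      rintro rfl
      simp [hn] at hd
    · rw [mul_zero, map_zero]
  unfold ominusEntry
  conv_lhs => rw [intervalSeries_pred hp h]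
  rw [← mul_assoc, pairing_add_left (isAdic_intervalSeries _ _) (hX.mul hE),
    mul_comm (PowerSeries.C _), mul_assoc, pairing_X_mul_left, pairing_C_mul hE]

/-- From (1 + βu⁻¹)^(1-k) = (1 + βu⁻¹)(1 + βu⁻¹)^(-k). -/
theorem ominusEntry_pred_pred (q p : ℕ) (k m : ℤ) :
    ominusEntry β q p (k - 1) (m - 1) =
      ominusEntry β q p k (m - 1) + MvPowerSeries.C β * ominusEntry β q p k m := by
  have hE := isAdic_intervalSeries (R := R) q p
  unfold ominusEntry
  have h : ((oneSubUnit (-β) ^ (-(k - 1)) : (PowerSeries R)ˣ) : PowerSeries R) =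
      ((oneSubUnit (-β) ^ (-k) : (PowerSeries R)ˣ) : PowerSeries R) +
        PowerSeries.C β * (PowerSeries.X *
          ((oneSubUnit (-β) ^ (-k) : (PowerSeries R)ˣ) : PowerSeries R)) := by
    rw [show -(k - 1) = 1 + -k by ring, zpow_add, zpow_one, Units.val_mul]
    change (1 - PowerSeries.C (-β) * PowerSeries.X) * _ = _
    rw [map_neg]
    ring
  rw [h, pairing_add_right hE, pairing_C_mul_right hE, pairing_X_mul_right hE, sub_add_cancel]

theorem ominusEntry_of_lt {q p : ℕ} (h : p < q) {k m : ℤ} (hm : 0 < m) :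
    ominusEntry β q p k m = 0 := by
  rw [ominusEntry, intervalSeries_of_lt h, pairing_one_left _ hm]

/-- For k ≤ 0 the factor (1 + βu⁻¹)^(-k) is a polynomial of degree at most -k in u⁻¹, and E has no
negative powers of u; exponents below k cannot occur. -/
theorem ominusEntry_eq_zero (q p : ℕ) {k m : ℤ} (hk : k ≤ 0) (hm : m < k) :
    ominusEntry β q p k m = 0 := by
  refine formalSum_eq_zero fun b => ?_
  rcases lt_or_ge (m + b) 0 with hb | hb
  · rw [intCoeff_of_neg _ hb, zero_mul]
  · have hpow : PowerSeries.coeff b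
        ((oneSubUnit (-β) ^ (-k) : (PowerSeries R)ˣ) : PowerSeries R) = 0 := by
      obtain ⟨j, rfl⟩ : ∃ j : ℕ, k = -j := ⟨(-k).toNat, by omega⟩
      rw [neg_neg, zpow_natCast, Units.val_pow_eq_pow_val]
      have : (oneSubUnit (-β) : PowerSeries R) =
          ((1 + Polynomial.C β * Polynomial.X : Polynomial R) : PowerSeries R) := by
        simp [oneSubUnit]
      rw [this, ← Polynomial.coe_pow, Polynomial.coeff_coe]
      apply Polynomial.coeff_eq_zero_of_natDegree_lt
      have h1 : (1 + Polynomial.C β * Polynomial.X : Polynomial R).natDegree ≤ 1 := by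
        compute_degree
      have h2 := Polynomial.natDegree_pow_le_of_le j h1
      omega
    rw [hpow, map_zero, mul_zero]

/-- `∏_{q ≤ l ≤ p} (1 + β x_l)`. -/
noncomputable def linProd (q p : ℕ) : MvPowerSeries ℕ R :=
  ∏ l ∈ Finset.Icc q p, (1 + MvPowerSeries.C β * MvPowerSeries.X l)

theorem linProd_pred {q p : ℕ} (hp : 1 ≤ p) (h : q ≤ p) :
    linProd β q p = linProd β q (p - 1) * (1 + MvPowerSeries.C β * MvPowerSeries.X p) :=
  prod_Icc_pred _ hp h

/-- The indices (k-1, m-1) are those of the next matrix row when two rows have equal length, which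
makes this the source of the row operation. -/
theorem ominusEntry_factor_mul {q p : ℕ} (hp : 1 ≤ p) (h : q ≤ p) (k m : ℤ) :
    (1 + MvPowerSeries.C β * MvPowerSeries.X p) * ominusEntry β q p k m =
      ominusEntry β q (p - 1) k m +
        MvPowerSeries.X p * ominusEntry β q p (k - 1) (m - 1) := by
  have h1 := ominusEntry_pred β hp h k m
  have h2 := ominusEntry_pred_pred β q p k m
  linear_combination h1 - MvPowerSeries.X p * h2

/-- The entry is ∑ h_b[X](-β)^b = ∏ (1 + βx_l)⁻¹, so an empty row has weighted diagonal entry 1. -/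
theorem linProd_mul_ominusEntry {q : ℕ} (hq : 1 ≤ q) (p : ℕ) :
    linProd β q p * ominusEntry β q p 1 0 = 1 := by
  have hlt : ∀ p < q, linProd β q p * ominusEntry β q p 1 0 = 1 := by
    intro p hp
    rw [linProd, Finset.Icc_eq_empty (by omega), Finset.prod_empty, one_mul, ominusEntry,
      intervalSeries_of_lt hp]
    unfold pairing
    rw [formalSum_succ (isAdic_one.locallyFinite _ 0), formalSum_eq_zero fun b => ?_]
    · rw [← Nat.cast_zero, ← Nat.cast_add, intCoeff_natCast]
      simp [oneSubUnit]
    · rw [zero_add, intCoeff_natCast, PowerSeries.coeff_one, if_neg (by omega), zero_mul]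
  induction p with
  | zero => exact hlt 0 hq
  | succ p ih =>
    rcases lt_or_ge (p + 1) q with h | h
    · exact hlt _ h
    · have h0 : ominusEntry β q (p + 1) (1 - 1) (0 - 1) = 0 :=
        ominusEntry_eq_zero β q _ (by norm_num) (by norm_num)
      rw [linProd_pred β (by omega) h, mul_assoc, ominusEntry_factor_mul β (by omega) h, h0,
        Nat.add_sub_cancel, mul_zero, add_zero, ih]

/-- Binomial series: `(1 + β u) ^ r = ∑ binom(r, s) β ^ s u ^ s` for `r : ℤ`. -/
theorem coeff_oneSubUnit_zpow (r : ℤ) (s : ℕ) :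
    PowerSeries.coeff s ((oneSubUnit (-β) ^ r : (PowerSeries R)ˣ) : PowerSeries R) =
      ((Ring.choose r s : ℤ) : R) * β ^ s := by
  set T : ℤ → PowerSeries R := fun r => PowerSeries.mk fun s => ((Ring.choose r s : ℤ) : R) * β ^ s
  -- Pascal's rule. As 1 + βu is a unit and T 0 = 1, it determines T r for negative r too.
  have hT : ∀ r, T (r + 1) = (oneSubUnit (-β) : PowerSeries R) * T r := by
    intro r
    change _ = (1 - PowerSeries.C (-β) * PowerSeries.X) * T r
    ext n
    rw [map_neg, neg_mul, sub_neg_eq_add, add_mul, one_mul, mul_assoc, map_add,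
      PowerSeries.coeff_C_mul]
    cases n with
    | zero => simp [T]
    | succ n =>
      simp only [T, PowerSeries.coeff_mk, PowerSeries.coeff_succ_X_mul, Ring.choose_succ_succ]
      push_cast
      ring
  have h : ∀ r : ℤ, ((oneSubUnit (-β) ^ r : (PowerSeries R)ˣ) : PowerSeries R) = T r := by
    intro r
    induction r using Int.induction_on with
    | zero =>
      ext n
      simp only [T, zpow_zero, Units.val_one, PowerSeries.coeff_mk, PowerSeries.coeff_one,
        Ring.choose_zero_ite]
      split_ifs with hn <;> simp [hn]
    | succ i ih => rw [hT, ← ih, zpow_add, zpow_one, Units.val_mul, mul_comm]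
    | pred i ih =>
      apply (oneSubUnit (-β)).isUnit.mul_left_cancel
      rw [← hT, sub_add_cancel, ← ih, ← Units.val_mul, ← zpow_one_add]
      congr 2
      ring
  rw [h, PowerSeries.coeff_mk]

theorem matsumuraG_eq_pairing (p q : ℕ) (m : ℤ) :
    matsumuraG β p q m = linProd β q p * ominusEntry β q p 1 m := by
  have hP : matsumuraProd β p q = PowerSeries.C (linProd β q p) *
      (intervalSeries R q p : PowerSeries (MvPowerSeries ℕ R)) := by
    rw [matsumuraProd, Finset.prod_mul_distrib, intervalSeries_eq_prod, linProd, map_prod]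
  rw [ominusEntry, ← pairing_C_mul (isAdic_intervalSeries q p), ← hP]
  unfold matsumuraG pairing
  congr! 2 with k
  rw [mul_comm]
  congr 2
  rw [zpow_neg, zpow_one]
  exact (PowerSeries.coeff_mk _ _).symm

/-- The binomial sum multiplies the generating function by (1 + βu⁻¹)^r, and its own factor (1 +
βu⁻¹)⁻¹ leaves the exponent r - 1. -/
theorem formalSum_choose_matsumuraG (p q : ℕ) (r m : ℤ) :
    (formalSum fun s : ℕ => MvPowerSeries.C (((Ring.choose r s : ℤ) : R) * β ^ s) *
      matsumuraG β p q (m + s)) = linProd β q p * ominusEntry β q p (1 - r) m := by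
  have hE := isAdic_intervalSeries (R := R) q p
  rw [ominusEntry, show -(1 - r) = r + -1 by ring, zpow_add, Units.val_mul,
    ← pairing_C_mul hE, pairing_mul_right ((isAdic_C _).mul hE)]
  congr! 2 with s
  rw [coeff_oneSubUnit_zpow, matsumuraG_eq_pairing, pairing_C_mul hE, ominusEntry]

end IntervalSeries

/-! ### Removing the largest entry from set-valued tableaux -/

section Tableaux

variable {R : Type*} [CommRing R]

/-- Set-valued tableaux on an arbitrary finite set of cells. -/
def IsSVT {D : Finset (ℕ × ℕ)} (T : D → Finset ℕ) : Prop :=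
  (∀ c, (T c).Nonempty ∧ ∀ a ∈ T c, 1 ≤ a) ∧
  (∀ c c' : D, c'.1 = (c.1.1, c.1.2 + 1) → ∀ a ∈ T c, ∀ b ∈ T c', a ≤ b) ∧
  (∀ c c' : D, c'.1 = (c.1.1 + 1, c.1.2) → ∀ a ∈ T c, ∀ b ∈ T c', a < b)

open scoped Classical in
/-- The set-valued tableaux on `D` whose entries in row `i` lie in `{g_i, …, f_i}`. -/
noncomputable def flaggedTableaux (D : Finset (ℕ × ℕ)) (f g : ℕ → ℕ) : Finset (D → Finset ℕ) :=
  (Fintype.piFinset fun c : D => (Finset.Icc (g c.1.1) (f c.1.1)).powerset).filter IsSVT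

theorem mem_flaggedTableaux {D : Finset (ℕ × ℕ)} {f g : ℕ → ℕ} {T : D → Finset ℕ} :
    T ∈ flaggedTableaux D f g ↔ (∀ c, ∀ a ∈ T c, g c.1.1 ≤ a ∧ a ≤ f c.1.1) ∧ IsSVT T := by
  simp [flaggedTableaux, Finset.subset_iff]

/-- `β ^ (|S| - 1) x ^ S`. -/
noncomputable def cellWeight (β : R) (S : Finset ℕ) : MvPowerSeries ℕ R :=
  MvPowerSeries.C (β ^ (S.card - 1)) * ∏ a ∈ S, MvPowerSeries.X a

/-- The generating function of the flagged set-valued tableaux on `D`. -/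
noncomputable def tableauSum (β : R) (D : Finset (ℕ × ℕ)) (f g : ℕ → ℕ) : MvPowerSeries ℕ R :=
  ∑ T ∈ flaggedTableaux D f g, ∏ c, cellWeight β (T c)

theorem flaggedG_eq_tableauSum (β : R) (lam mu : YoungDiagram) (f g : ℕ → ℕ) :
    (flaggedG β lam mu f g : MvPowerSeries ℕ R) = tableauSum β (skewCells lam mu) f g := by
  change MvPolynomial.coeToMvPowerSeries.ringHom (flaggedG β lam mu f g) = _
  rw [flaggedG, map_sum]
  refine Finset.sum_congr rfl fun T hT => ?_
  have hne : ∀ c, 1 ≤ (T c).card := fun c =>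
    Finset.card_pos.2 ((mem_flaggedTableaux.1 hT).2.1 c).1
  -- Cells are nonempty, so the truncated subtractions are exact and the power of β splits over the
  -- cells.
  have hcard : (∑ c, (T c).card) - (skewCells lam mu).card = ∑ c, ((T c).card - 1) := by
    rw [Finset.sum_tsub_distrib _ fun c _ => hne c]
    simp
  simp only [cellWeight, Finset.prod_mul_distrib, ← map_prod, Finset.prod_pow_eq_pow_sum, hcard,
    map_mul]
  simp [MvPolynomial.coeToMvPowerSeries.ringHom_apply, map_prod]

theorem cellWeight_insert (β : R) {S : Finset ℕ} {p : ℕ} (hS : S.Nonempty) (hp : p ∉ S) :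
    cellWeight β (insert p S) = MvPowerSeries.C β * MvPowerSeries.X p * cellWeight β S := by
  have h := Finset.card_pos.2 hS
  rw [cellWeight, cellWeight, Finset.card_insert_of_notMem hp, Finset.prod_insert hp,
    show S.card + 1 - 1 = S.card - 1 + 1 by omega, pow_succ, map_mul]
  ring

theorem cellWeight_singleton (β : R) (p : ℕ) : cellWeight β {p} = MvPowerSeries.X p := by
  simp [cellWeight]

theorem prod_cellWeight_update (β : R) {D : Finset (ℕ × ℕ)} (T : D → Finset ℕ) (c : D)
    (S : Finset ℕ) : ∏ d, cellWeight β (Function.update T c S d) =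
      cellWeight β S * ∏ d ∈ Finset.univ.erase c, cellWeight β (T d) := by
  rw [← Finset.mul_prod_erase _ _ (Finset.mem_univ c), Function.update_self]
  congr 1
  refine Finset.prod_congr rfl fun d hd => ?_
  rw [Function.update_of_ne (Finset.ne_of_mem_erase hd)]

variable {D : Finset (ℕ × ℕ)} {f g : ℕ → ℕ}

/-- The cell `c` is the last one of a contiguous row of `D`. -/
def IsRowEnd (D : Finset (ℕ × ℕ)) (c : ℕ × ℕ) : Prop :=
  c ∈ D ∧ ∀ j, (c.1, j) ∈ D → j ≤ c.2 ∧ ∀ j', j ≤ j' → j' ≤ c.2 → (c.1, j') ∈ D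

theorem IsSVT.le_rowEnd {T : D → Finset ℕ} (hT : IsSVT T) {c : ℕ × ℕ} (hc : IsRowEnd D c) {j : ℕ}
    (hj : (c.1, j) ∈ D) (hjc : j ≠ c.2) : ∀ a ∈ T ⟨(c.1, j), hj⟩, ∀ b ∈ T ⟨c, hc.1⟩, a ≤ b := by
  have hle := (hc.2 j hj).1
  obtain ⟨k, hk⟩ : ∃ k, c.2 = j + k := Nat.exists_eq_add_of_le hle
  induction k generalizing j with
  | zero => omega
  | succ k ih =>
    intro a ha b hb
    have hj1 : (c.1, j + 1) ∈ D := (hc.2 j hj).2 (j + 1) (by omega) (by omega)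
    rcases Nat.eq_zero_or_pos k with rfl | hk0
    · exact hT.2.1 ⟨(c.1, j), hj⟩ ⟨c, hc.1⟩ (Prod.ext rfl (by simpa using hk)) a ha b hb
    · obtain ⟨e, he⟩ := (hT.1 ⟨(c.1, j + 1), hj1⟩).1
      exact (hT.2.1 ⟨(c.1, j), hj⟩ ⟨(c.1, j + 1), hj1⟩ rfl a ha e he).trans
        (ih hj1 (by omega) (by omega) (by omega) e he b hb)

/-- Rows increase weakly: an f_i anywhere in row i forces every entry of the last cell to be f_i, so
testing that cell suffices. -/
theorem flaggedTableaux_update {c : ℕ × ℕ} (hc : IsRowEnd D c) (hf : 1 ≤ f c.1) :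
    flaggedTableaux D (Function.update f c.1 (f c.1 - 1)) g =
      (flaggedTableaux D f g).filter fun T => f c.1 ∉ T ⟨c, hc.1⟩ := by
  ext T
  rw [Finset.mem_filter, mem_flaggedTableaux, mem_flaggedTableaux]
  constructor
  · rintro ⟨h, hT⟩
    refine ⟨⟨fun d a ha => ⟨(h d a ha).1, (h d a ha).2.trans ?_⟩, hT⟩, fun hmem => ?_⟩
    · rw [Function.update_apply]
      split_ifs with hd
      · rw [hd]; omega
      · exact le_rfl
    · have := (h _ _ hmem).2
      rw [Function.update_self] at this
      omega
  · rintro ⟨⟨h, hT⟩, hmem⟩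
    refine ⟨fun d a ha => ⟨(h d a ha).1, ?_⟩, hT⟩
    rw [Function.update_apply]
    split_ifs with hd
    · suffices a ≠ f c.1 by
        have := (h d a ha).2
        rw [hd] at this
        omega
      rintro rfl
      obtain ⟨⟨i, j⟩, hmemD⟩ := d
      obtain rfl : i = c.1 := hd
      by_cases hj : j = c.2
      · subst hj
        exact hmem ha
      · obtain ⟨b, hb⟩ := (hT.1 ⟨c, hc.1⟩).1
        have h1 := hT.le_rowEnd hc hmemD hj _ ha b hb
        have h2 := (h _ b hb).2
        obtain rfl : b = f c.1 := le_antisymm h2 h1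
        exact hmem hb
    · exact (h d a ha).2

/-- Lowering a flag which is forced to be strict by the row below. -/
theorem tableauSum_update_of_below (β : R) {c : ℕ × ℕ} (hc : IsRowEnd D c) (hf : 1 ≤ f c.1)
    (hbelow : (c.1 + 1, c.2) ∈ D) (hff : f (c.1 + 1) = f c.1) :
    tableauSum β D f g = tableauSum β D (Function.update f c.1 (f c.1 - 1)) g := by
  rw [tableauSum, tableauSum, flaggedTableaux_update hc hf, Finset.filter_true_of_mem]
  intro T hT hmem
  obtain ⟨h, hT⟩ := mem_flaggedTableaux.1 hT
  obtain ⟨b, hb⟩ := (hT.1 ⟨_, hbelow⟩).1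
  have h1 := hT.2.2 ⟨c, hc.1⟩ ⟨_, hbelow⟩ rfl _ hmem b hb
  have h2 := (h _ b hb).2
  simp only at h2
  omega

/-- A corner is constrained only from the left and from above, by lower bounds on its entries. This
covers both erasing and inserting f_i. -/
theorem IsSVT.update {T : D → Finset ℕ} (hT : IsSVT T) {c : D}
    (hright : (c.1.1, c.1.2 + 1) ∉ D) (hdown : (c.1.1 + 1, c.1.2) ∉ D) {S : Finset ℕ}
    (hS : S.Nonempty) (h : ∀ s ∈ S, ∃ b ∈ T c, b ≤ s) : IsSVT (Function.update T c S) := by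
  refine ⟨fun d => ?_, fun d d' hd a ha b hb => ?_, fun d d' hd a ha b hb => ?_⟩
  · rcases eq_or_ne d c with rfl | hdc
    · rw [Function.update_self]
      refine ⟨hS, fun a ha => ?_⟩
      obtain ⟨b, hb, hba⟩ := h a ha
      exact ((hT.1 d).2 b hb).trans hba
    · rw [Function.update_of_ne hdc]
      exact hT.1 d
  · have hdc : d ≠ c := by
      rintro rfl
      exact hright (hd ▸ d'.2)
    rw [Function.update_of_ne hdc] at ha
    rcases eq_or_ne d' c with rfl | hdc'
    · rw [Function.update_self] at hb
      obtain ⟨e, he, heb⟩ := h b hb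
      exact (hT.2.1 d d' hd a ha e he).trans heb
    · rw [Function.update_of_ne hdc'] at hb
      exact hT.2.1 d d' hd a ha b hb
  · have hdc : d ≠ c := by
      rintro rfl
      exact hdown (hd ▸ d'.2)
    rw [Function.update_of_ne hdc] at ha
    rcases eq_or_ne d' c with rfl | hdc'
    · rw [Function.update_self] at hb
      obtain ⟨e, he, heb⟩ := h b hb
      exact (hT.2.2 d d' hd a ha e he).trans_le heb
    · rw [Function.update_of_ne hdc'] at hb
      exact hT.2.2 d d' hd a ha b hb

/-- The tableaux with the entry `f_i` and another one in the corner cell. -/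
theorem sum_corner_mem (β : R) {c : ℕ × ℕ} (hc : IsRowEnd D c)
    (hdown : (c.1 + 1, c.2) ∉ D) (hf : 1 ≤ f c.1) (hgf : g c.1 ≤ f c.1) :
    ∑ T ∈ (flaggedTableaux D f g).filter
        (fun T => f c.1 ∈ T ⟨c, hc.1⟩ ∧ T ⟨c, hc.1⟩ ≠ {f c.1}), ∏ d, cellWeight β (T d) =
      MvPowerSeries.C β * MvPowerSeries.X (f c.1) *
        tableauSum β D (Function.update f c.1 (f c.1 - 1)) g := by
  have hright : (c.1, c.2 + 1) ∉ D := fun h => by have := (hc.2 _ h).1; omega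
  set c' : D := ⟨c, hc.1⟩
  rw [tableauSum, flaggedTableaux_update hc hf, Finset.mul_sum]
  refine Finset.sum_nbij' (fun T => Function.update T c' ((T c').erase (f c.1)))
    (fun T => Function.update T c' (insert (f c.1) (T c'))) ?_ ?_ ?_ ?_ ?_
  · intro T hT
    simp only [Finset.mem_filter, mem_flaggedTableaux] at hT ⊢
    obtain ⟨⟨h, hsvt⟩, hmem, hne⟩ := hT
    refine ⟨⟨fun d a ha => ?_, hsvt.update hright hdown ?_ ?_⟩, ?_⟩
    · rcases eq_or_ne d c' with rfl | hd
      · rw [Function.update_self] at ha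
        exact h _ a (Finset.mem_of_mem_erase ha)
      · rw [Function.update_of_ne hd] at ha
        exact h _ a ha
    · rw [Finset.nonempty_iff_ne_empty]
      intro h0
      rcases (Finset.erase_eq_empty_iff _ _).1 h0 with h1 | h1
      · simp [h1] at hmem
      · exact hne h1
    · exact fun s hs => ⟨s, Finset.mem_of_mem_erase hs, le_rfl⟩
    · change f c.1 ∉ Function.update T c' _ c'
      rw [Function.update_self]
      exact Finset.notMem_erase _ _
  · intro T hT
    simp only [Finset.mem_filter, mem_flaggedTableaux] at hT ⊢
    obtain ⟨⟨h, hsvt⟩, hmem⟩ := hT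
    obtain ⟨b, hb⟩ := (hsvt.1 c').1
    refine ⟨⟨fun d a ha => ?_, hsvt.update hright hdown (Finset.insert_nonempty _ _) ?_⟩, ?_, ?_⟩
    · rcases eq_or_ne d c' with rfl | hd
      · rw [Function.update_self] at ha
        rcases Finset.mem_insert.1 ha with rfl | ha
        · exact ⟨hgf, le_rfl⟩
        · exact h _ a ha
      · rw [Function.update_of_ne hd] at ha
        exact h _ a ha
    · intro s hs
      rcases Finset.mem_insert.1 hs with rfl | hs
      · exact ⟨b, hb, (h _ b hb).2⟩
      · exact ⟨s, hs, le_rfl⟩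
    · simp
    · rw [Function.update_self]
      intro h0
      have : b ∈ insert (f c.1) (T c') := Finset.mem_insert_of_mem hb
      rw [h0, Finset.mem_singleton] at this
      exact hmem (this ▸ hb)
  · intro T hT
    simp only [Finset.mem_filter] at hT
    simp [Finset.insert_erase hT.2.1]
  · intro T hT
    simp only [Finset.mem_filter] at hT
    have hT2 : f c.1 ∉ T c' := hT.2
    simp [Finset.erase_insert hT2]
  · intro T hT
    simp only [Finset.mem_filter, mem_flaggedTableaux] at hT
    obtain ⟨⟨h, hsvt⟩, hmem, hne⟩ := hT
    rw [prod_cellWeight_update, ← mul_assoc, ← cellWeight_insert _ _ (Finset.notMem_erase _ _),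
      Finset.insert_erase hmem,
      Finset.mul_prod_erase _ (fun d => cellWeight β (T d)) (Finset.mem_univ c')]
    rw [Finset.nonempty_iff_ne_empty]
    intro h0
    rcases (Finset.erase_eq_empty_iff _ _).1 h0 with h1 | h1
    · simp [h1] at hmem
    · exact hne h1

/-- The tableaux with the single entry `f_i` in the corner cell. -/
theorem sum_corner_singleton (β : R) {c : ℕ × ℕ} (hc : IsRowEnd D c)
    (hdown : (c.1 + 1, c.2) ∉ D) (hf : 1 ≤ f c.1) (hgf : g c.1 ≤ f c.1)
    (hup : ∀ i, c.1 = i + 1 → (i, c.2) ∈ D → f i < f c.1) :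
    ∑ T ∈ (flaggedTableaux D f g).filter (fun T => T ⟨c, hc.1⟩ = {f c.1}),
        ∏ d, cellWeight β (T d) =
      MvPowerSeries.X (f c.1) * tableauSum β (D.erase c) f g := by
  have hright : (c.1, c.2 + 1) ∉ D := fun h => by have := (hc.2 _ h).1; omega
  rw [tableauSum, Finset.mul_sum]
  have hmemD : ∀ d : ((D.erase c : Finset (ℕ × ℕ)) : Type), d.1 ∈ D := fun d =>
    Finset.mem_of_mem_erase d.2
  refine Finset.sum_nbij' (fun T d => T ⟨d.1, hmemD d⟩)
    (fun T d => if h : d.1 = c then {f c.1} else T ⟨d.1, Finset.mem_erase.2 ⟨h, d.2⟩⟩)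
    ?_ ?_ ?_ ?_ ?_
  · intro T hT
    simp only [Finset.mem_filter, mem_flaggedTableaux] at hT ⊢
    obtain ⟨⟨h, hsvt⟩, -⟩ := hT
    exact ⟨fun d => h _, fun d => hsvt.1 _, fun d d' hd => hsvt.2.1 _ _ hd,
      fun d d' hd => hsvt.2.2 _ _ hd⟩
  · intro T hT
    simp only [Finset.mem_filter, mem_flaggedTableaux] at hT ⊢
    obtain ⟨h, hsvt⟩ := hT
    refine ⟨⟨fun d a ha => ?_, fun d => ?_, fun d d' hd a ha b hb => ?_,
      fun d d' hd a ha b hb => ?_⟩, by simp⟩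
    · by_cases hdc : d.1 = c
      · rw [dif_pos hdc, Finset.mem_singleton] at ha
        rw [hdc, ha]
        exact ⟨hgf, le_rfl⟩
      · rw [dif_neg hdc] at ha
        exact h _ a ha
    · beta_reduce
      by_cases hdc : d.1 = c
      · rw [dif_pos hdc]
        simpa using hf
      · rw [dif_neg hdc]
        exact hsvt.1 _
    · beta_reduce at ha hb
      have hdc : d.1 ≠ c := fun h0 => hright (by rw [← h0, ← hd]; exact d'.2)
      rw [dif_neg hdc] at ha
      by_cases hdc' : d'.1 = c
      · rw [dif_pos hdc', Finset.mem_singleton] at hb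
        have h1 := (h _ a ha).2
        have h2 : d.1.1 = c.1 := by rw [← hdc', hd]
        simp only [h2] at h1
        omega
      · rw [dif_neg hdc'] at hb
        exact hsvt.2.1 _ _ hd a ha b hb
    · beta_reduce at ha hb
      have hdc : d.1 ≠ c := fun h0 => hdown (by rw [← h0, ← hd]; exact d'.2)
      rw [dif_neg hdc] at ha
      by_cases hdc' : d'.1 = c
      · rw [dif_pos hdc', Finset.mem_singleton] at hb
        have h1 := (h _ a ha).2
        -- Refilling the corner with {f_i} keeps the column strict because the flag of the row above
        -- is smaller.
        have h3 := hup d.1.1 (by rw [← hdc', hd]) (by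
          have : c.2 = d.1.2 := by rw [← hdc', hd]
          rw [this]
          exact d.2)
        simp only at h1
        omega
      · rw [dif_neg hdc'] at hb
        exact hsvt.2.2 _ _ hd a ha b hb
  · intro T hT
    simp only [Finset.mem_filter] at hT
    funext d
    by_cases hdc : d.1 = c
    · rw [dif_pos hdc, ← hT.2]
      congr 1
      exact Subtype.ext hdc.symm
    · rw [dif_neg hdc]
  · intro T hT
    funext d
    simp only
    rw [dif_neg (Finset.ne_of_mem_erase d.2)]
  · intro T hT
    simp only [Finset.mem_filter] at hT
    rw [← Finset.mul_prod_erase _ _ (Finset.mem_univ (⟨c, hc.1⟩ : D)), hT.2, cellWeight_singleton]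
    congr 1
    refine Finset.prod_bij' (fun d hd => ⟨d.1, Finset.mem_erase.2
        ⟨fun h => Finset.ne_of_mem_erase hd (Subtype.ext h), d.2⟩⟩)
      (fun d _ => ⟨d.1, hmemD d⟩) ?_ ?_ ?_ ?_ ?_
    · simp
    · intro d _
      exact Finset.mem_erase.2
        ⟨fun h => Finset.ne_of_mem_erase d.2 (congrArg Subtype.val h), Finset.mem_univ _⟩
    · simp
    · simp
    · simp

/-- Removing the entry `f_i` from the last cell of row `i`. -/
theorem tableauSum_corner (β : R) {c : ℕ × ℕ} (hc : IsRowEnd D c)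
    (hdown : (c.1 + 1, c.2) ∉ D) (hf : 1 ≤ f c.1) (hgf : g c.1 ≤ f c.1)
    (hup : ∀ i, c.1 = i + 1 → (i, c.2) ∈ D → f i < f c.1) :
    tableauSum β D f g = (1 + MvPowerSeries.C β * MvPowerSeries.X (f c.1)) *
        tableauSum β D (Function.update f c.1 (f c.1 - 1)) g +
      MvPowerSeries.X (f c.1) * tableauSum β (D.erase c) f g := by
  rw [← sum_corner_singleton β hc hdown hf hgf hup, one_add_mul, ← sum_corner_mem β hc hdown hf hgf]
  conv_rhs => rw [tableauSum, flaggedTableaux_update hc hf]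
  rw [tableauSum, Finset.sum_filter, Finset.sum_filter, Finset.sum_filter,
    ← Finset.sum_add_distrib, ← Finset.sum_add_distrib]
  refine Finset.sum_congr rfl fun T _ => ?_
  by_cases h1 : f c.1 ∈ T ⟨c, hc.1⟩
  · by_cases h2 : T ⟨c, hc.1⟩ = {f c.1}
    · simp [h2]
    · simp [h1, h2]
  · have h2 : T ⟨c, hc.1⟩ ≠ {f c.1} := fun h => h1 (by rw [h]; exact Finset.mem_singleton_self _)
    simp [h1, h2]

theorem tableauSum_eq_zero (β : R) {c : ℕ × ℕ} (hc : c ∈ D) (h : f c.1 < g c.1) :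
    tableauSum β D f g = 0 := by
  refine Finset.sum_eq_zero fun T hT => ?_
  obtain ⟨h1, hT⟩ := mem_flaggedTableaux.1 hT
  obtain ⟨b, hb⟩ := (hT.1 ⟨c, hc⟩).1
  have := h1 _ b hb
  simp only at this
  omega

theorem tableauSum_empty (β : R) (f g : ℕ → ℕ) : tableauSum β ∅ f g = 1 := by
  have h : flaggedTableaux ∅ f g = Finset.univ :=
    Finset.eq_univ_of_forall fun T => mem_flaggedTableaux.2 ⟨fun c => isEmptyElim c,
      fun c => isEmptyElim c, fun c => isEmptyElim c, fun c => isEmptyElim c⟩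
  rw [tableauSum, h]
  simp

end Tableaux

/-! ### The same recursions for the determinants -/

section Determinant

variable {R : Type*} [CommRing R] (β : R)

/-- The cells of the skew shape with rows `{μ_i, …, λ_i - 1}`, `i < N`. -/
def rowCells (N : ℕ) (lam mu : ℕ → ℕ) : Finset (ℕ × ℕ) :=
  (Finset.range N).biUnion fun i => (Finset.Ico (mu i) (lam i)).image (Prod.mk i)

theorem mem_rowCells {N : ℕ} {lam mu : ℕ → ℕ} {c : ℕ × ℕ} :
    c ∈ rowCells N lam mu ↔ c.1 < N ∧ mu c.1 ≤ c.2 ∧ c.2 < lam c.1 := by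
  obtain ⟨i, j⟩ := c
  simp only [rowCells, Finset.mem_biUnion, Finset.mem_range, Finset.mem_image, Finset.mem_Ico,
    Prod.mk.injEq]
  constructor
  · rintro ⟨i, hi, j, hj, rfl, rfl⟩
    exact ⟨hi, hj⟩
  · rintro ⟨hi, hj⟩
    exact ⟨i, hi, j, hj, rfl, rfl⟩

/-- Shapes with `N` rows whose flags increase along connected rows. -/
structure IsFlaggedShape (N : ℕ) (lam mu f g : ℕ → ℕ) : Prop where
  lam_anti : ∀ i, i + 1 < N → lam (i + 1) ≤ lam i
  mu_anti : ∀ i, i + 1 < N → mu (i + 1) ≤ mu i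
  mu_le_lam : ∀ i < N, mu i ≤ lam i
  one_le : ∀ i < N, 1 ≤ g i
  flag : ∀ i, i + 1 < N → mu i < lam (i + 1) → g i ≤ g (i + 1) ∧ f i ≤ f (i + 1)

theorem antitone_of_succ_le {N : ℕ} {v : ℕ → ℕ} (h : ∀ i, i + 1 < N → v (i + 1) ≤ v i) {i j : ℕ}
    (hij : i ≤ j) (hj : j < N) : v j ≤ v i := by
  induction j, hij using Nat.le_induction with
  | base => exact le_rfl
  | succ j _ ih => exact (h j hj).trans (ih (by omega))

theorem IsFlaggedShape.flag_le {N : ℕ} {lam mu f g : ℕ → ℕ} (h : IsFlaggedShape N lam mu f g)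
    {i j : ℕ} (hij : i ≤ j) (hj : j < N) (hc : ∀ k, i ≤ k → k < j → mu k < lam (k + 1)) :
    g i ≤ g j ∧ f i ≤ f j := by
  induction j, hij using Nat.le_induction with
  | base => exact ⟨le_rfl, le_rfl⟩
  | succ j hij ih =>
    have h1 := ih (by omega) fun k hk hkj => hc k hk (by omega)
    have h2 := h.flag j hj (hc j hij (by omega))
    exact ⟨h1.1.trans h2.1, h1.2.trans h2.2⟩

/-- The weights `W(g_i, g_j, f_i)` for which the determinants below agree. -/
structure IsFlagWeight (W : ℕ → ℕ → ℕ → MvPowerSeries ℕ R) : Prop where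
  diag : ∀ q p, W q q p = linProd β q p
  pred : ∀ q q' p, 1 ≤ p → q ≤ p → q' ≤ p →
    W q q' p = W q q' (p - 1) * (1 + MvPowerSeries.C β * MvPowerSeries.X p)
  shift : ∀ q r p, 1 ≤ p → q ≤ p → ∃ ρ, ∀ q' ≤ p, W q q' (p - 1) = ρ * W r q' p

theorem isUnit_linProd (q p : ℕ) : IsUnit (linProd β q p) := by
  rw [MvPowerSeries.isUnit_iff_constantCoeff, linProd, map_prod]
  simp

theorem isUnit_linFactor (p : ℕ) :
    IsUnit (1 + MvPowerSeries.C β * MvPowerSeries.X p : MvPowerSeries ℕ R) := by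
  rw [MvPowerSeries.isUnit_iff_constantCoeff]
  simp

/-- The weight of Matsumura's matrix; here ρ = (1 + βx_p)⁻¹, which exists over power series. -/
theorem isFlagWeight_column : IsFlagWeight β fun _ q' p => linProd β q' p where
  diag _ _ := rfl
  pred _ _ _ hp _ hq' := linProd_pred β hp hq'
  shift _ _ p hp _ := by
    obtain ⟨u, hu⟩ := isUnit_linFactor β p
    refine ⟨(u⁻¹ : (MvPowerSeries ℕ R)ˣ), fun q' hq' => ?_⟩
    rw [linProd_pred β hp hq', ← hu, mul_comm, Units.mul_inv_cancel_right]

/-- The weight of formula (1): it is constant along rows and comes out of the determinant as the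
product prefactor. -/
theorem isFlagWeight_row : IsFlagWeight β fun q _ p => linProd β q p where
  diag _ _ := rfl
  pred _ _ _ hp hq _ := linProd_pred β hp hq
  shift q r p _ _ := by
    obtain ⟨u, hu⟩ := isUnit_linProd β r p
    refine ⟨linProd β q (p - 1) * (u⁻¹ : (MvPowerSeries ℕ R)ˣ), fun q' _ => ?_⟩
    simp only [← hu, Units.inv_mul_cancel_right]

variable (W : ℕ → ℕ → ℕ → MvPowerSeries ℕ R)

/-- The matrix with entries `W(g_i, g_j, f_i) h_{λ_i-μ_j-i+j}[X_{[g_j,f_i]} ⊖ (j-i+1)(-β)]`. -/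
noncomputable def weightedMatrix (N : ℕ) (lam mu f g : ℕ → ℕ) :
    Matrix (Fin N) (Fin N) (MvPowerSeries ℕ R) :=
  Matrix.of fun i j => W (g i) (g j) (f i) *
    ominusEntry β (g j) (f i) ((j : ℤ) - (i : ℤ) + 1)
      ((lam i : ℤ) - (mu j : ℤ) - (i : ℤ) + (j : ℤ))

variable {β W}

/-- If q' > p the alphabet is empty and the recursion for x_p is unavailable; the other two
alternatives make all three terms vanish. The bound 1 < m keeps m - 1 positive. -/
theorem IsFlagWeight.entry_corner (hW : IsFlagWeight β W) {q q' p : ℕ} {k m : ℤ} (hp : 1 ≤ p)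
    (hq : q ≤ p) (h : q' ≤ p ∨ 1 < m ∨ (m < k ∧ k ≤ 0)) :
    W q q' p * ominusEntry β q' p k m =
      (1 + MvPowerSeries.C β * MvPowerSeries.X p) * (W q q' (p - 1) * ominusEntry β q' (p - 1) k m) +
        MvPowerSeries.X p * (W q q' p * ominusEntry β q' p k (m - 1)) := by
  by_cases hq' : q' ≤ p
  · rw [ominusEntry_pred β hp hq' k m, hW.pred q q' p hp hq hq']
    ring
  · rcases h.resolve_left hq' with hm | ⟨hm, hk⟩
    · rw [ominusEntry_of_lt β (by omega) (by omega), ominusEntry_of_lt β (by omega) (by omega),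
        ominusEntry_of_lt β (by omega) (by omega)]
      ring
    · rw [ominusEntry_eq_zero β _ _ hk hm, ominusEntry_eq_zero β _ _ hk hm,
        ominusEntry_eq_zero β _ _ hk (by omega)]
      ring

/-- Since ρ does not depend on the column data q', k, m, the identity is a row operation. -/
theorem IsFlagWeight.entry_shift (hW : IsFlagWeight β W) {q p : ℕ} (r : ℕ) (hp : 1 ≤ p)
    (hq : q ≤ p) : ∃ ρ, ∀ (q' : ℕ) (k m : ℤ), (q' ≤ p ∨ 1 < m ∨ (m < k ∧ k ≤ 0)) →
      W q q' p * ominusEntry β q' p k m =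
        W q q' (p - 1) * ominusEntry β q' (p - 1) k m +
          ρ * (W r q' p * ominusEntry β q' p (k - 1) (m - 1)) := by
  obtain ⟨ρ, hρ⟩ := hW.shift q r p hp hq
  refine ⟨MvPowerSeries.X p * ρ, fun q' k m h => ?_⟩
  by_cases hq' : q' ≤ p
  · rw [hW.pred q q' p hp hq hq', mul_assoc, ominusEntry_factor_mul β hp hq', mul_add]
    linear_combination MvPowerSeries.X p * ominusEntry β q' p (k - 1) (m - 1) * hρ q' hq'
  · rcases h.resolve_left hq' with hm | ⟨hm, hk⟩
    · rw [ominusEntry_of_lt β (by omega) (by omega), ominusEntry_of_lt β (by omega) (by omega),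
        ominusEntry_of_lt β (by omega) (by omega)]
      ring
    · rw [ominusEntry_eq_zero β _ _ hk hm, ominusEntry_eq_zero β _ _ hk hm,
        ominusEntry_eq_zero β _ _ (by omega) (by omega)]
      ring

variable {N : ℕ} {lam mu f g : ℕ → ℕ}

theorem IsFlaggedShape.entry_bounds_of_split (h : IsFlaggedShape N lam mu f g) {i j t : ℕ}
    (hjt : j ≤ t) (hti : t < i) (hi : i < N) (ht : lam (t + 1) ≤ mu t) :
    (lam i : ℤ) - mu j - i + j < (j : ℤ) - i + 1 ∧ (j : ℤ) - i + 1 ≤ 0 := by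
  have h1 := antitone_of_succ_le h.lam_anti (show t + 1 ≤ i by omega) hi
  have h2 := antitone_of_succ_le h.mu_anti hjt (by omega)
  omega

/-- Right of the diagonal m ≥ 2. Left of it, either the rows between are connected and g_j ≤ g_i, or
a break between them puts the entry in the vanishing range. -/
theorem IsFlaggedShape.entry_cases (h : IsFlaggedShape N lam mu f g) {i j : ℕ} (hi : i < N)
    (hj : j < N) (hne : mu i < lam i) {p : ℕ} (hp : g i ≤ p) :
    g j ≤ p ∨ 1 < (lam i : ℤ) - mu j - i + j ∨
      ((lam i : ℤ) - mu j - i + j < (j : ℤ) - i + 1 ∧ (j : ℤ) - i + 1 ≤ 0) := by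
  rcases lt_trichotomy i j with hij | rfl | hij
  · have := antitone_of_succ_le h.mu_anti hij.le hj
    omega
  · exact Or.inl hp
  · by_cases hc : ∀ k, j ≤ k → k < i → mu k < lam (k + 1)
    · exact Or.inl ((h.flag_le hij.le hi hc).1.trans hp)
    · push Not at hc
      obtain ⟨t, hjt, hti, ht⟩ := hc
      exact Or.inr (Or.inr (h.entry_bounds_of_split hjt hti hi ht))

theorem weightedMatrix_split (h : IsFlaggedShape N lam mu f g) {i j : Fin N} {t : ℕ}
    (hjt : j.1 ≤ t) (hti : t < i.1) (ht : lam (t + 1) ≤ mu t) :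
    weightedMatrix β W N lam mu f g i j = 0 := by
  obtain ⟨h1, h2⟩ := h.entry_bounds_of_split hjt hti i.2 ht
  rw [weightedMatrix, Matrix.of_apply, ominusEntry_eq_zero β _ _ h2 h1, mul_zero]

/-- For an empty last row, the last matrix row is (0, …, 0, 1). -/
theorem det_weightedMatrix_succ (hW : IsFlagWeight β W) (h : IsFlaggedShape (N + 1) lam mu f g)
    (hN : lam N = mu N) :
    (weightedMatrix β W (N + 1) lam mu f g).det = (weightedMatrix β W N lam mu f g).det := by
  rw [Matrix.det_succ_row _ (Fin.last N), Fin.sum_univ_castSucc, Finset.sum_eq_zero, zero_add]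
  · have hdiag : weightedMatrix β W (N + 1) lam mu f g (Fin.last N) (Fin.last N) = 1 := by
      rw [weightedMatrix, Matrix.of_apply, hW.diag]
      convert linProd_mul_ominusEntry β (h.one_le N (by omega)) (f N) using 3 <;> simp [hN]
    rw [hdiag, ← two_mul, pow_mul]
    simp only [even_two, Even.neg_pow, one_pow, mul_one, one_mul, Fin.succAbove_last]
    rfl
  · intro j _
    have hj := antitone_of_succ_le h.mu_anti (show j.1 ≤ N by omega) (by omega)
    have hz : weightedMatrix β W (N + 1) lam mu f g (Fin.last N) j.castSucc = 0 := by
      rw [weightedMatrix, Matrix.of_apply]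
      simp only [Fin.val_last, Fin.val_castSucc]
      rw [ominusEntry_eq_zero β _ _ (by omega) (by omega), mul_zero]
    rw [hz]
    ring

/-- The matrix is block triangular at breaks of the shape. In the block connected to the last row
f_i ≤ f_N < g_N, so its last column has empty alphabets and positive degrees, hence is zero. -/
theorem det_weightedMatrix_eq_zero (h : IsFlaggedShape (N + 1) lam mu f g)
    (hN : mu N < lam N) (hfg : f N < g N) :
    (weightedMatrix β W (N + 1) lam mu f g).det = 0 := by
  classical
  rw [Matrix.twoBlockTriangular_det _ fun i : Fin (N + 1) =>
    ∃ t, i.1 ≤ t ∧ t < N ∧ lam (t + 1) ≤ mu t]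
  · refine mul_eq_zero_of_right _ (Matrix.det_eq_zero_of_column_eq_zero
      ⟨Fin.last N, fun ⟨t, h1, h2, _⟩ => by simp only [Fin.val_last] at h1; omega⟩ ?_)
    rintro ⟨i, hi⟩
    push Not at hi
    have h1 := h.flag_le (show i.1 ≤ N by omega) (by omega) hi
    have h2 : lam N ≤ lam i := antitone_of_succ_le h.lam_anti (by omega) (by omega)
    rw [Matrix.toSquareBlockProp_def, Matrix.of_apply, weightedMatrix, Matrix.of_apply]
    simp only [Fin.val_last]
    rw [ominusEntry_of_lt β (by omega) (by omega), mul_zero]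
  · rintro i hi j ⟨t, h1, h2, h3⟩
    refine weightedMatrix_split h h1 ?_ h3
    by_contra hti
    exact hi ⟨t, by omega, h2, h3⟩

theorem weightedMatrix_row_flag (i : Fin N) (p : ℕ) {i' : Fin N} (hi' : i' ≠ i) :
    weightedMatrix β W N lam mu (Function.update f i p) g i' = weightedMatrix β W N lam mu f g i' := by
  have hne : (i' : ℕ) ≠ i := fun h => hi' (Fin.ext h)
  funext j
  simp only [weightedMatrix, Matrix.of_apply, Function.update_of_ne hne]

theorem weightedMatrix_row_lam (i : Fin N) (p : ℕ) {i' : Fin N} (hi' : i' ≠ i) :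
    weightedMatrix β W N (Function.update lam i p) mu f g i' = weightedMatrix β W N lam mu f g i' := by
  have hne : (i' : ℕ) ≠ i := fun h => hi' (Fin.ext h)
  funext j
  simp only [weightedMatrix, Matrix.of_apply, Function.update_of_ne hne]

theorem det_eq_of_row {A : Type*} [CommRing A] {n : Type*} [Fintype n] [DecidableEq n]
    {M M' M'' : Matrix n n A} {i : n} {a b : A} (h' : ∀ k, k ≠ i → M' k = M k)
    (h'' : ∀ k, k ≠ i → M'' k = M k) (hi : ∀ j, M i j = a * M' i j + b * M'' i j) :
    M.det = a * M'.det + b * M''.det := by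
  have e : ∀ L : Matrix n n A, (∀ k, k ≠ i → L k = M k) → M.updateRow i (L i) = L := by
    intro L hL
    refine Matrix.ext fun k j => ?_
    rw [Matrix.updateRow_apply]
    split_ifs with hk
    · rw [hk]
    · rw [hL k hk]
  have hM : M = M.updateRow i (a • M' i + b • M'' i) := by
    conv_lhs => rw [← Matrix.updateRow_eq_self M i]
    congr 1
    funext j
    simp [hi j]
  conv_lhs => rw [hM]
  rw [Matrix.det_updateRow_add, Matrix.det_updateRow_smul, Matrix.det_updateRow_smul, e M' h', e M'' h'']

theorem det_weightedMatrix_corner (hW : IsFlagWeight β W) (h : IsFlaggedShape N lam mu f g)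
    {i : ℕ} (hi : i < N) (hne : mu i < lam i) (hgf : g i ≤ f i) :
    (weightedMatrix β W N lam mu f g).det =
      (1 + MvPowerSeries.C β * MvPowerSeries.X (f i)) *
          (weightedMatrix β W N lam mu (Function.update f i (f i - 1)) g).det +
        MvPowerSeries.X (f i) *
          (weightedMatrix β W N (Function.update lam i (lam i - 1)) mu f g).det := by
  refine det_eq_of_row (i := ⟨i, hi⟩) (fun k hk => weightedMatrix_row_flag ⟨i, hi⟩ _ hk)
    (fun k hk => weightedMatrix_row_lam ⟨i, hi⟩ _ hk) fun j => ?_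
  simp only [weightedMatrix, Matrix.of_apply, Function.update_self]
  -- The natural subtraction is exact because mu i < lam i.
  have hcast : ((lam i - 1 : ℕ) : ℤ) - mu j - i + j = (lam i : ℤ) - mu j - i + j - 1 := by
    omega
  rw [hcast]
  exact hW.entry_corner ((h.one_le i hi).trans hgf) hgf (h.entry_cases hi j.2 hne hgf)

theorem det_weightedMatrix_shift (hW : IsFlagWeight β W) (h : IsFlaggedShape N lam mu f g)
    {i : ℕ} (hi : i + 1 < N) (hne : mu i < lam i) (hgf : g i ≤ f i) (hlam : lam (i + 1) = lam i)
    (hf : f (i + 1) = f i) :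
    (weightedMatrix β W N lam mu f g).det =
      (weightedMatrix β W N lam mu (Function.update f i (f i - 1)) g).det := by
  obtain ⟨ρ, hρ⟩ := hW.entry_shift (g (i + 1)) ((h.one_le i (by omega)).trans hgf) hgf
  have hne' : (⟨i, by omega⟩ : Fin N) ≠ ⟨i + 1, hi⟩ := by simp
  rw [← Matrix.det_updateRow_add_smul_self
    (weightedMatrix β W N lam mu (Function.update f i (f i - 1)) g) hne' ρ]
  congr 1
  refine Matrix.ext fun k j => ?_
  rw [Matrix.updateRow_apply]
  split_ifs with hk
  · subst hk
    rw [Pi.add_apply, Pi.smul_apply, smul_eq_mul,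
      weightedMatrix_row_flag (β := β) (W := W) ⟨i, by omega⟩ _ hne'.symm]
    simp only [weightedMatrix, Matrix.of_apply, Function.update_self, hlam, hf]
    rw [hρ (g j) _ _ (h.entry_cases (by omega) j.2 hne hgf)]
    push_cast
    congr! 4 <;> ring
  · exact (congrFun (weightedMatrix_row_flag (β := β) (W := W) ⟨i, by omega⟩ _ hk) j).symm

theorem isRowEnd_rowCells {i : ℕ} (hi : i < N) (hne : mu i < lam i) :
    IsRowEnd (rowCells N lam mu) (i, lam i - 1) := by
  refine ⟨mem_rowCells.2 ⟨hi, ?_⟩, fun j hj => ?_⟩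
  · simp only
    omega
  · have hj := (mem_rowCells.1 hj).2
    simp only at hj
    refine ⟨by simp only; omega, fun j' h1 h2 => mem_rowCells.2 ⟨hi, ?_⟩⟩
    simp only at h2 ⊢
    omega

theorem rowCells_update {i : ℕ} (hi : i < N) (hne : mu i < lam i) :
    (rowCells N lam mu).erase (i, lam i - 1) =
      rowCells N (Function.update lam i (lam i - 1)) mu := by
  ext ⟨k, j⟩
  simp only [Finset.mem_erase, mem_rowCells, Function.update_apply, ne_eq, Prod.mk.injEq]
  split_ifs with hk
  · subst hk
    simp only [true_and]
    omega
  · simp [hk]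

theorem sum_update_lt {v : ℕ → ℕ} {i : ℕ} (hi : i < N) (hv : 1 ≤ v i) :
    ∑ k ∈ Finset.range N, Function.update v i (v i - 1) k < ∑ k ∈ Finset.range N, v k := by
  refine Finset.sum_lt_sum (fun k _ => ?_) ⟨i, Finset.mem_range.2 hi, ?_⟩
  · rw [Function.update_apply]
    split_ifs with h
    · rw [h]; omega
    · exact le_rfl
  · rw [Function.update_self]
    omega

/-- Only the comparison with a connected row above can fail when f_i drops, so strictness there is
enough. -/
theorem IsFlaggedShape.update_flag (h : IsFlaggedShape N lam mu f g) {i : ℕ}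
    (hprev : ∀ k, i = k + 1 → mu k < lam i → f k < f i) :
    IsFlaggedShape N lam mu (Function.update f i (f i - 1)) g := by
  refine ⟨h.lam_anti, h.mu_anti, h.mu_le_lam, h.one_le, fun k hk hc => ?_⟩
  have h1 := h.flag k hk hc
  refine ⟨h1.1, ?_⟩
  rw [Function.update_apply, Function.update_apply]
  split_ifs with e1 e2 e2
  · omega
  · subst e1; omega
  · have := hprev k e2.symm (e2 ▸ hc)
    omega
  · exact h1.2

theorem IsFlaggedShape.update_lam (h : IsFlaggedShape N lam mu f g) {i : ℕ}
    (hne : mu i < lam i) (hnext : i + 1 < N → lam (i + 1) < lam i) :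
    IsFlaggedShape N (Function.update lam i (lam i - 1)) mu f g := by
  refine ⟨fun k hk => ?_, h.mu_anti, fun k hk => ?_, h.one_le, fun k hk hc => ?_⟩
  · have := h.lam_anti k hk
    rw [Function.update_apply, Function.update_apply]
    split_ifs with e1 e2 e2
    · omega
    · rw [← e1]; omega
    · subst e2
      have := hnext hk
      omega
    · exact this
  · have := h.mu_le_lam k hk
    rw [Function.update_apply]
    split_ifs with e
    · subst e; omega
    · exact this
  · refine h.flag k hk (hc.trans_le ?_)
    rw [Function.update_apply]
    split_ifs with e
    · rw [e]; omega
    · exact le_rfl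

/-- The flagged Jacobi–Trudi formula for set-valued tableaux. -/
theorem tableauSum_eq_det (hW : IsFlagWeight β W) (h : IsFlaggedShape N lam mu f g) :
    tableauSum β (rowCells N lam mu) f g = (weightedMatrix β W N lam mu f g).det := by
  -- Each reduction drops a row, a cell or a flag value, and lowers this sum.
  induction hs : N + ∑ k ∈ Finset.range N, lam k + ∑ k ∈ Finset.range N, f k
    using Nat.strong_induction_on generalizing N lam f with
  | _ s ih =>
  cases N with
  | zero => rw [Matrix.det_fin_zero, rowCells, Finset.range_zero, Finset.biUnion_empty, tableauSum_empty]
  | succ N =>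
  rcases (h.mu_le_lam N (by omega)).eq_or_lt with hN | hN
  · rw [det_weightedMatrix_succ hW h hN.symm]
    have hcells : rowCells (N + 1) lam mu = rowCells N lam mu := by
      ext ⟨k, j⟩
      simp only [mem_rowCells]
      constructor
      · rintro ⟨hk, hj⟩
        refine ⟨?_, hj⟩
        by_contra hkN
        obtain rfl : k = N := by omega
        omega
      · rintro ⟨hk, hj⟩
        exact ⟨by omega, hj⟩
    rw [hcells]
    rw [Finset.sum_range_succ, Finset.sum_range_succ] at hs
    exact ih _ (by omega) ⟨fun i hi => h.lam_anti i (by omega), fun i hi => h.mu_anti i (by omega),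
      fun i hi => h.mu_le_lam i (by omega), fun i hi => h.one_le i (by omega),
      fun i hi => h.flag i (by omega)⟩ rfl
  · rcases lt_or_ge (f N) (g N) with hfg | hfg
    · rw [det_weightedMatrix_eq_zero h hN hfg]
      exact tableauSum_eq_zero β (c := (N, mu N)) (mem_rowCells.2 ⟨by simp, le_rfl, hN⟩) hfg
    · have hex : ∃ i, ∀ k, i ≤ k → k < N → mu k < lam (k + 1) ∧ f k = f (k + 1) :=
        ⟨N, fun k _ _ => by omega⟩
      classical
      obtain ⟨i, hi, hmin⟩ : ∃ i, (∀ k, i ≤ k → k < N → mu k < lam (k + 1) ∧ f k = f (k + 1)) ∧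
          ∀ i' < i, ¬ ∀ k, i' ≤ k → k < N → mu k < lam (k + 1) ∧ f k = f (k + 1) :=
        ⟨Nat.find hex, Nat.find_spec hex, fun i' => Nat.find_min hex⟩
      have hiN : i ≤ N := by
        by_contra hlt
        exact hmin N (by omega) fun k _ _ => by omega
      have hgi := (h.flag_le hiN (by omega) fun k hk hkN => (hi k hk hkN).1).1
      have hfi : f i = f N := by
        have hall : ∀ k, i ≤ k → k ≤ N → f i = f k := by
          intro k hk
          induction k, hk using Nat.le_induction with
          | base => exact fun _ => rfl
          | succ k hk ih' => exact fun hkN => (ih' (by omega)).trans (hi k hk (by omega)).2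
        exact hall N hiN le_rfl
      have hgf : g i ≤ f i := by omega
      have hf1 : 1 ≤ f i := (h.one_le i (by omega)).trans hgf
      have hne : mu i < lam i := by
        rcases hiN.eq_or_lt with rfl | hlt
        · exact hN
        · exact (hi i le_rfl hlt).1.trans_le (h.lam_anti i (by omega))
      have hprev : ∀ k, i = k + 1 → mu k < lam i → f k < f i := by
        rintro k rfl hk
        refine lt_of_le_of_ne (h.flag k (by omega) hk).2 fun heq => hmin k (by omega) fun l hl hlN => ?_
        rcases hl.eq_or_lt with rfl | hlt
        · exact ⟨hk, heq⟩
        · exact hi l hlt hlN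
      have hend := isRowEnd_rowCells (mu := mu) (show i < N + 1 by omega) hne
      have hflag := h.update_flag hprev
      have hsf := sum_update_lt (show i < N + 1 by omega) hf1
      by_cases hnext : i + 1 < N + 1 → lam (i + 1) < lam i
      · rw [det_weightedMatrix_corner hW h (by omega) hne hgf, tableauSum_corner β hend ?_ hf1 hgf ?_,
          rowCells_update (by omega) hne]
        · have hsl := sum_update_lt (v := lam) (show i < N + 1 by omega) (by omega)
          simp only
          rw [ih _ (by omega) hflag rfl, ih _ (by omega) (h.update_lam hne hnext) rfl]
        · intro hmem
          obtain ⟨h1, -, h2⟩ := mem_rowCells.1 hmem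
          simp only at h1 h2
          have := hnext h1
          omega
        · intro k hk hmem
          obtain ⟨-, h1, -⟩ := mem_rowCells.1 hmem
          simp only at h1 hk ⊢
          exact hprev k hk (by omega)
      -- Rows i and i+1 end in the same column with equal flags: column strictness already excludes
      -- f_i from row i.
      · push Not at hnext
        obtain ⟨hi1, hle⟩ := hnext
        obtain ⟨hc, hff⟩ := hi i le_rfl (by omega)
        have hlam := le_antisymm (h.lam_anti i hi1) hle
        rw [det_weightedMatrix_shift hW h hi1 hne hgf hlam hff.symm,
          tableauSum_update_of_below β hend hf1 (mem_rowCells.2 ⟨hi1, ?_⟩) hff.symm]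
        · exact ih _ (by simp only; omega) hflag rfl
        · have := h.mu_anti i hi1
          simp only
          omega

end Determinant

/-! ### The specialization α = 0, b = -β, and the stated matrices -/

section Specialization

variable {R : Type*} [CommRing R] (β : R)

/-- The elements of `S` other than its minimum. -/
def nonMin (S : Finset ℕ) : Finset ℕ := S.filter fun k => ∃ a ∈ S, a < k

theorem card_nonMin {S : Finset ℕ} (hS : S.Nonempty) : (nonMin S).card + 1 = S.card := by
  have h : nonMin S = S.erase (S.min' hS) := by
    ext k
    simp only [nonMin, Finset.mem_filter, Finset.mem_erase]
    constructor
    · rintro ⟨hk, a, ha, hak⟩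
      exact ⟨((S.min'_le a ha).trans_lt hak).ne', hk⟩
    · rintro ⟨hne, hk⟩
      exact ⟨hk, _, S.min'_mem hS, lt_of_le_of_ne (S.min'_le k hk) (Ne.symm hne)⟩
  rw [h, Finset.card_erase_add_one (S.min'_mem hS)]

/-- A cell with a single unmarked entry is a set all of whose entries but the minimum are marked. -/
theorem eq_of_card_le_marked {m : Multiset ℕ} {s : Finset ℕ} (hm : m ≠ 0)
    (hs : ∀ k ∈ s, k ∈ m ∧ ∃ a ∈ m, a < k) (hcard : m.card ≤ s.card + 1) :
    m = m.toFinset.val ∧ s = nonMin m.toFinset := by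
  have hne : m.toFinset.Nonempty := Multiset.toFinset_nonempty.2 hm
  have hsub : s ⊆ nonMin m.toFinset := fun k hk => by
    obtain ⟨h1, a, ha, hak⟩ := hs k hk
    exact Finset.mem_filter.2 ⟨Multiset.mem_toFinset.2 h1, a, Multiset.mem_toFinset.2 ha, hak⟩
  have h1 := Finset.card_le_card hsub
  have h2 := card_nonMin hne
  have h3 := m.toFinset_card_le
  refine ⟨?_, Finset.eq_of_subset_of_card_le hsub (by omega)⟩
  rw [Multiset.toFinset_val, (Multiset.toFinset_card_eq_card_iff_nodup.1 (by omega)).dedup]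

/-- Marking all entries of each cell but the smallest one. -/
def markedTableau {D : Finset (ℕ × ℕ)} (S : D → Finset ℕ) (c : D) : Multiset ℕ × Finset ℕ :=
  ((S c).val, nonMin (S c))

theorem wtMMSVT_markedTableau {lam mu : YoungDiagram} (S : skewCells lam mu → Finset ℕ)
    (hS : ∀ c, (S c).Nonempty) :
    wtMMSVT (fun _ => 0) (fun _ => -β) (markedTableau S) = ∏ c, cellWeight β (S c) := by
  refine Finset.prod_congr rfl fun c _ => ?_
  have h := card_nonMin (hS c)
  have h1 : (S c).val.card - (nonMin (S c)).card - 1 = 0 := by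
    rw [Finset.card_val]
    omega
  have h2 : (nonMin (S c)).card = (S c).card - 1 := by omega
  simp only [markedTableau, h1, pow_zero, one_mul, neg_neg]
  rw [h2, mul_comm]
  rfl

theorem wtMMSVT_eq_zero {lam mu : YoungDiagram}
    {T : skewCells lam mu → Multiset ℕ × Finset ℕ} {c : skewCells lam mu}
    (hc : ¬ (T c).1.card ≤ (T c).2.card + 1) :
    wtMMSVT (fun _ => 0) (fun _ => -β) T = 0 := by
  refine Finset.prod_eq_zero (Finset.mem_univ c) ?_
  rw [zero_pow (by omega), zero_mul, map_zero, mul_zero]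

theorem markedTableau_mem {lam mu : YoungDiagram} {f g : ℕ → ℕ}
    {S : skewCells lam mu → Finset ℕ} (hS : S ∈ flaggedTableaux (skewCells lam mu) f g) :
    markedTableau S ∈ MMSVTrow lam mu g f := by
  obtain ⟨h, hS⟩ := mem_flaggedTableaux.1 hS
  refine ⟨⟨fun c => ⟨?_, (hS.1 c).2, fun k hk => ?_⟩, hS.2.1, hS.2.2⟩, h⟩
  · rw [markedTableau, Ne, Finset.val_eq_zero]
    exact (hS.1 c).1.ne_empty
  · exact Finset.mem_filter.1 hk

/-- Since 0^(unmarked-1) kills every cell with two or more unmarked entries, the surviving cells are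
sets with all entries but the minimum marked, weighted by β^(|S|-1). -/
theorem rowG_eq_tableauSum (lam mu : YoungDiagram) (f g : ℕ → ℕ) :
    rowG (fun _ => 0) (fun _ => -β) lam mu g f = tableauSum β (skewCells lam mu) f g := by
  classical
  ext d
  let Φ : {S // S ∈ flaggedTableaux (skewCells lam mu) f g} → MMSVTrow lam mu g f :=
    fun S => ⟨markedTableau S.1, markedTableau_mem S.2⟩
  have hΦ : Function.Injective Φ := by
    intro S S' h
    refine Subtype.ext (funext fun c => Finset.val_injective ?_)
    exact congrArg Prod.fst (congrFun (congrArg Subtype.val h) c)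
  have hcoeff : MvPowerSeries.coeff d (rowG (fun _ => 0) (fun _ => -β) lam mu g f) =
      ∑ᶠ T : MMSVTrow lam mu g f,
        MvPowerSeries.coeff d (wtMMSVT (fun _ => 0) (fun _ => -β) T.1) := rfl
  rw [hcoeff]
  -- Multiset fillings can be infinite in number; only those coming from set-valued tableaux have
  -- nonzero weight.
  rw [finsum_eq_sum_of_support_subset (s := (flaggedTableaux (skewCells lam mu) f g).attach.image Φ),
    Finset.sum_image hΦ.injOn, tableauSum, map_sum,
    ← Finset.sum_attach (flaggedTableaux (skewCells lam mu) f g)]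
  · refine Finset.sum_congr rfl fun S _ => ?_
    have hne : ∀ c, (S.1 c).Nonempty := fun c => ((mem_flaggedTableaux.1 S.2).2.1 c).1
    have hval : (Φ S).1 = markedTableau S.1 := rfl
    rw [hval, wtMMSVT_markedTableau β S.1 hne]
  · rintro ⟨T, hT⟩ hne
    have hcard : ∀ c, (T c).1.card ≤ (T c).2.card + 1 := by
      by_contra hc
      push Not at hc
      obtain ⟨c, hc⟩ := hc
      exact hne (by simp only [wtMMSVT_eq_zero β (T := T) (c := c) (by omega), map_zero])
    have hcell := fun c => eq_of_card_le_marked (hT.1.1 c).1 (hT.1.1 c).2.2 (hcard c)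
    have hS : (fun c => (T c).1.toFinset) ∈ flaggedTableaux (skewCells lam mu) f g := by
      refine mem_flaggedTableaux.2 ⟨fun c a ha => hT.2 c a (Multiset.mem_toFinset.1 ha),
        fun c => ⟨Multiset.toFinset_nonempty.2 (hT.1.1 c).1,
          fun a ha => (hT.1.1 c).2.1 a (Multiset.mem_toFinset.1 ha)⟩, ?_, ?_⟩
      · exact fun c c' h a ha b hb =>
          hT.1.2.1 c c' h a (Multiset.mem_toFinset.1 ha) b (Multiset.mem_toFinset.1 hb)
      · exact fun c c' h a ha b hb =>
          hT.1.2.2 c c' h a (Multiset.mem_toFinset.1 ha) b (Multiset.mem_toFinset.1 hb)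
    rw [Finset.mem_coe, Finset.mem_image]
    refine ⟨⟨_, hS⟩, Finset.mem_attach _ _, Subtype.ext (funext fun c => ?_)⟩
    exact Prod.ext (hcell c).1.symm (hcell c).2.symm

theorem oneSubUnit_zero {A : Type*} [CommRing A] : oneSubUnit (0 : A) = 1 := by
  ext1
  simp [oneSubUnit]

/-- Letters equal to 0 contribute the factor 1; what remains is j + 1 - i copies of the letter -β.
-/
theorem plethSeries_row (a b i j : ℕ) :
    plethSeries (Asum a - Asum b - Bsum i + Bsum (j + 1))
      (Sum.elim (fun _ => 0) (fun _ => -β)) = oneSubUnit (-β) ^ (-((j : ℤ) - i + 1)) := by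
  have hA : ∀ n, plethSeries (Asum n) (Sum.elim (fun _ => 0) (fun _ => -β)) = 1 := by
    intro n
    rw [Asum, plethSeries_sum]
    exact Finset.prod_eq_one fun k _ => by rw [plethSeries_single, Sum.elim_inl, oneSubUnit_zero, one_zpow]
  have hB : ∀ n : ℕ, plethSeries (Bsum n) (Sum.elim (fun _ => 0) (fun _ => -β)) =
      oneSubUnit (-β) ^ (-(n : ℤ)) := by
    intro n
    rw [Bsum, plethSeries_sum]
    simp only [plethSeries_single, Sum.elim_inr, Finset.prod_const, Nat.card_Icc,
      Nat.add_sub_cancel]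
    rw [zpow_neg, zpow_neg, zpow_one, zpow_natCast, inv_pow]
  rw [plethSeries_add, sub_eq_add_neg, plethSeries_add, plethSeries_neg, sub_eq_add_neg,
    plethSeries_add, plethSeries_neg, hA, hA, hB, hB, inv_one, one_mul, one_mul, ← zpow_neg,
    ← zpow_add]
  congr 1
  push_cast
  ring

theorem rowMatrix_eq_ominusMatrix (n : ℕ) (lam mu : YoungDiagram) (f g : ℕ → ℕ)
    (i j : Fin n) :
    rowMatrix (fun _ => 0) (fun _ => -β) n lam mu g f i j =
      ominusEntry β (g j) (f i) ((j : ℤ) - (i : ℤ) + 1)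
        ((lam.rowLen i : ℤ) - (mu.rowLen j : ℤ) - (i : ℤ) + (j : ℤ)) := by
  rw [rowMatrix, Matrix.of_apply, ominusH_eq_pairing, plethSeries_row, ominusEntry]

theorem ominusMatrix_apply (lam mu : YoungDiagram) (f g : ℕ → ℕ) (i j : Fin (numParts lam)) :
    ominusMatrix β lam mu f g i j =
      ominusEntry β (g j) (f i) ((j : ℤ) - (i : ℤ) + 1)
        ((lam.rowLen i : ℤ) - (mu.rowLen j : ℤ) - (i : ℤ) + (j : ℤ)) := by
  rw [ominusMatrix, Matrix.of_apply, ominusH_single]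

theorem matsumuraMatrix_apply (lam mu : YoungDiagram) (f g : ℕ → ℕ) (i j : Fin (numParts lam)) :
    matsumuraMatrix β lam mu f g i j =
      linProd β (g j) (f i) * ominusMatrix β lam mu f g i j := by
  rw [ominusMatrix_apply, matsumuraMatrix, Matrix.of_apply, formalSum_choose_matsumuraG]
  congr 2
  ring

theorem skewCells_eq_rowCells (lam mu : YoungDiagram) :
    skewCells lam mu = rowCells (numParts lam) lam.rowLen mu.rowLen := by
  ext ⟨i, j⟩
  rw [skewCells, Finset.mem_sdiff, YoungDiagram.mem_cells, YoungDiagram.mem_cells,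
    YoungDiagram.mem_iff_lt_rowLen, YoungDiagram.mem_iff_lt_rowLen, mem_rowCells, not_lt, and_comm]
  refine ⟨fun h => ⟨?_, h⟩, fun h => h.2⟩
  rw [numParts, ← YoungDiagram.mem_iff_lt_colLen, YoungDiagram.mem_iff_lt_rowLen]
  exact (Nat.zero_le _).trans_lt h.2

theorem isFlaggedShape_rowLen {n : ℕ} {lam mu : YoungDiagram} {f g : ℕ → ℕ}
    (hlam : numParts lam ≤ n) (hsub : mu ≤ lam) (hg : ∀ i < n, 1 ≤ g i)
    (hflag : ∀ i, i + 1 < n → mu.rowLen i < lam.rowLen (i + 1) →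
      g i ≤ g (i + 1) ∧ f i ≤ f (i + 1)) :
    IsFlaggedShape (numParts lam) lam.rowLen mu.rowLen f g where
  lam_anti i _ := lam.rowLen_anti _ _ (Nat.le_succ i)
  mu_anti i _ := mu.rowLen_anti _ _ (Nat.le_succ i)
  mu_le_lam i _ := by
    by_contra h
    have h1 : (i, lam.rowLen i) ∈ lam :=
      hsub (YoungDiagram.mem_iff_lt_rowLen.2 (not_le.1 h))
    exact lt_irrefl _ (YoungDiagram.mem_iff_lt_rowLen.1 h1)
  one_le i hi := hg i (hi.trans_le hlam)
  flag i hi := hflag i (hi.trans_le hlam)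

theorem det_weightedMatrix_row (lam mu : YoungDiagram) (f g : ℕ → ℕ) :
    (weightedMatrix β (fun q _ p => linProd β q p) (numParts lam) lam.rowLen mu.rowLen f g).det =
      flagProd β (numParts lam) f g * (ominusMatrix β lam mu f g).det := by
  have h : flagProd β (numParts lam) f g = ∏ i : Fin (numParts lam), linProd β (g i) (f i) :=
    (Finset.prod_range fun i => linProd β (g i) (f i))
  rw [h, ← Matrix.det_mul_column]
  congr 1
  refine Matrix.ext fun i j => ?_
  rw [Matrix.of_apply, ominusMatrix_apply, weightedMatrix, Matrix.of_apply]

theorem weightedMatrix_column (lam mu : YoungDiagram) (f g : ℕ → ℕ) :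
    weightedMatrix β (fun _ q' p => linProd β q' p) (numParts lam) lam.rowLen mu.rowLen f g =
      matsumuraMatrix β lam mu f g := by
  refine Matrix.ext fun i j => ?_
  rw [matsumuraMatrix_apply, ominusMatrix_apply, weightedMatrix, Matrix.of_apply]

end Specialization

end FlaggedGrothendieck

theorem mainTheorem7 {R : Type*} [CommRing R] (β : R) (n : ℕ) (lam mu : YoungDiagram)
    (f g : ℕ → ℕ)
    (hlam : FlaggedGrothendieck.numParts lam ≤ n) (hmu : FlaggedGrothendieck.numParts mu ≤ n)
    (hsub : mu ≤ lam)
    (hf : ∀ i < n, 1 ≤ f i) (hg : ∀ i < n, 1 ≤ g i)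
    (hflag : ∀ i, i + 1 < n → mu.rowLen i < lam.rowLen (i + 1) →
      g i ≤ g (i + 1) ∧ f i ≤ f (i + 1)) :
    -- the reformulated determinant formula
    ((FlaggedGrothendieck.flaggedG β lam mu f g : MvPowerSeries ℕ R) =
      FlaggedGrothendieck.flagProd β (FlaggedGrothendieck.numParts lam) f g *
        (FlaggedGrothendieck.ominusMatrix β lam mu f g).det) ∧
    -- Matsumura's determinant formula
    ((FlaggedGrothendieck.flaggedG β lam mu f g : MvPowerSeries ℕ R) =
      (FlaggedGrothendieck.matsumuraMatrix β lam mu f g).det) ∧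
    -- the two right-hand sides agree; comparison of the matrix entries
    ((FlaggedGrothendieck.matsumuraMatrix β lam mu f g).det =
      FlaggedGrothendieck.flagProd β (FlaggedGrothendieck.numParts lam) f g *
        (FlaggedGrothendieck.ominusMatrix β lam mu f g).det) ∧
    (∀ i j : Fin (FlaggedGrothendieck.numParts lam),
      FlaggedGrothendieck.matsumuraMatrix β lam mu f g i j =
        (∏ l ∈ Finset.Icc (g j) (f i), (1 + MvPowerSeries.C β * MvPowerSeries.X l)) *
          FlaggedGrothendieck.ominusMatrix β lam mu f g i j) ∧
    -- both sides are the specializations `α = 0`, `β_i = -β`, `n = ℓ(λ)`, `r = g`, `s = f` of the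
    -- two sides of the general row-flagged formula
    (FlaggedGrothendieck.rowG (fun _ => 0) (fun _ => -β) lam mu g f =
      (FlaggedGrothendieck.flaggedG β lam mu f g : MvPowerSeries ℕ R)) ∧
    (FlaggedGrothendieck.rowProd (fun _ => -β) (FlaggedGrothendieck.numParts lam) g f =
      FlaggedGrothendieck.flagProd β (FlaggedGrothendieck.numParts lam) f g) ∧
    (FlaggedGrothendieck.rowMatrix (fun _ => 0) (fun _ => -β) (FlaggedGrothendieck.numParts lam)
      lam mu g f = FlaggedGrothendieck.ominusMatrix β lam mu f g) := by
  have hshape := FlaggedGrothendieck.isFlaggedShape_rowLen hlam hsub hg hflag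
  have h1 : (FlaggedGrothendieck.flaggedG β lam mu f g : MvPowerSeries ℕ R) =
      FlaggedGrothendieck.flagProd β (FlaggedGrothendieck.numParts lam) f g *
        (FlaggedGrothendieck.ominusMatrix β lam mu f g).det := by
    rw [FlaggedGrothendieck.flaggedG_eq_tableauSum, FlaggedGrothendieck.skewCells_eq_rowCells,
      FlaggedGrothendieck.tableauSum_eq_det (FlaggedGrothendieck.isFlagWeight_row β) hshape,
      FlaggedGrothendieck.det_weightedMatrix_row]
  have h2 : (FlaggedGrothendieck.flaggedG β lam mu f g : MvPowerSeries ℕ R) =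
      (FlaggedGrothendieck.matsumuraMatrix β lam mu f g).det := by
    rw [FlaggedGrothendieck.flaggedG_eq_tableauSum, FlaggedGrothendieck.skewCells_eq_rowCells,
      FlaggedGrothendieck.tableauSum_eq_det (FlaggedGrothendieck.isFlagWeight_column β) hshape,
      FlaggedGrothendieck.weightedMatrix_column]
  refine ⟨h1, h2, h2.symm.trans h1, FlaggedGrothendieck.matsumuraMatrix_apply β lam mu f g, ?_,
    ?_, Matrix.ext fun i j => ?_⟩
  · rw [FlaggedGrothendieck.flaggedG_eq_tableauSum, FlaggedGrothendieck.rowG_eq_tableauSum]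
  · simp only [FlaggedGrothendieck.rowProd, FlaggedGrothendieck.flagProd, map_neg, neg_mul,
      sub_neg_eq_add]
  · rw [FlaggedGrothendieck.rowMatrix_eq_ominusMatrix, FlaggedGrothendieck.ominusMatrix_apply]
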